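/- Let $(p_n)_{n\ge 0}$ be a sequence with $p_n\in(0,1)$, and write $p=p_n$. Let $G_{n,p}$ be the Erdős–Rényi random graph on the node set $V$ with $|V|=n$, in which each of the $\binom n2$ possible arcs $\{i,j\}$ is present independently with probability $p$. For a graph $G=(V,E)$ let $P_G=\operatorname{conv}\{\pm(\mathbf e_i-\mathbf e_j):\{i,j\}\in E\}\subset\mathbb R^V$ be its symmetric edge polytope. A face of a polytope is its intersection with a hyperplane such that the polytope is contained in exactly one of the two closed half-spaces of the hyperplane (so the polytope is not a face of itself), and an edge is a face whose affine hull has dimension one. Let $K_{n,p}$ be the number of edges of $P_{n,p}:=P_{G_{n,p}}$. For real sequences, $a_n\asymp b_n$ means $a_n\in\Theta(b_n)$, $a_n\gg b_n$ means $b_n\in o(a_n)$, and $a_n\lesssim b_n$ means $a_n\in O(b_n)$, all as $n\to\infty$. Then $$\operatorname{Var}(K_{n,p})\;\asymp\; n^6p^3(1-p)\bigl(1-\sqrt2\,p\bigr)^2+n^5p^3(1-p)+n^4p^2(1-p).$$ Moreover, if $p\gg n^{-2}$, then $\operatorname{Var}(K_{n,p})\asymp n^6p^3(1-p)(1-\sqrt2\,p)^2+n^5p^3(1-p)$,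 and if $p\lesssim n^{-2}$, then $\operatorname{Var}(K_{n,p})\asymp n^4p^2$. In particular, if $p=1/\sqrt2$ for all $n$, the leading term cancels and $\operatorname{Var}(K_{n,p})\asymp n^5$. Finally, $\operatorname{Var}(K_{n,p})\to\infty$ if and only if $p\gg n^{-2}$ and $1-p\gg n^{-6}$. -/

import Mathlib

open MeasureTheory ProbabilityTheory Filter Asymptotics
open scoped Topology

/-- `F` is a face of `P`: the intersection of `P` with a supporting hyperplane `{l = c}`, that is,
a hyperplane such that `P` lies in exactly one of its two closed half-spaces (up to replacing
`(l, c)` by `(-l, -c)` this is the half-space `{l ≤ c}`). In particular `P` itself is not a face. -/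
def IsPolytopeFace {E : Type*} [AddCommGroup E] [Module ℝ E] (P F : Set E) : Prop :=
  ∃ (l : E →ₗ[ℝ] ℝ) (c : ℝ), l ≠ 0 ∧ P ⊆ {x | l x ≤ c} ∧ ¬ P ⊆ {x | c ≤ l x} ∧
    F = P ∩ {x | l x = c}

/-- The edges of `P`: the faces whose affine hull has dimension one. -/
def polytopeEdges {E : Type*} [AddCommGroup E] [Module ℝ E] (P : Set E) : Set (Set E) :=
  {F | IsPolytopeFace P F ∧ Module.finrank ℝ (affineSpan ℝ F).direction = 1}

/-- The symmetric edge polytope of a graph `G`: the convex hull in `ℝ^V` of the points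
`e_i - e_j` over all ordered pairs `(i, j)` of adjacent nodes (so both signs occur). -/
def symmetricEdgePolytope {V : Type*} [DecidableEq V] (G : SimpleGraph V) : Set (V → ℝ) :=
  convexHull ℝ {x | ∃ i j : V, G.Adj i j ∧ x = Pi.single i 1 - Pi.single j 1}

/-- The number of edges of the symmetric edge polytope of `G`. -/
noncomputable def sepEdgeCount {V : Type*} [DecidableEq V] (G : SimpleGraph V) : ℕ :=
  (polytopeEdges (symmetricEdgePolytope G)).ncard

/-- The variance of the number of edges of the symmetric edge polytope of the Erdős–Rényi random
graph on `n` nodes, in which each arc is present independently with probability `p`. -/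
noncomputable def sepEdgeVariance (n : ℕ) (p : unitInterval) : ℝ :=
  variance (fun G : SimpleGraph (Fin n) => (sepEdgeCount G : ℝ))
    (SimpleGraph.binomialRandom (Fin n) p)

/-!
A pair of vertices `e_i - e_j`, `e_k - e_l` of the symmetric edge polytope spans an edge unless
their sum is also the sum of another pair of vertices, or a vertex, or zero. This happens only when
the two directed arcs form a path that can be replaced by a single arc or by another path of length
two, or when they are opposite arcs of a 4-cycle, or when they are reverse to each other
(`isTightPair_iff`). Hence the number of edges is `F - B` (`sepEdgeCount_fromEdgeSet`), where
`F = 4 * #(pairs of arcs) - 4 * #(4-cycles)` (`pairsMinusCycles`) and `B` counts the directed paths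
of length two with a replacement (`shortcutPaths`).

All variances are estimated by discrete derivatives `D_e`, the effect of switching one arc on. For a
function of independent Bernoulli variables the Efron–Stein inequality bounds the variance above by
`p (1 - p) ∑ E (D_e f)²` (`bernVar_le_sum_diffAt`), and Bessel's inequality bounds it below by
`p (1 - p) ∑ (E D_e f)²` (`sum_sq_bernExp_diffAt_le`) and by the analogous sum over second
derivatives (`sum_sq_bernExp_diffAt_diffAt_le`).

* Since `B` is monotone in the graph and `D_e B` is at most a multiple of the degrees of the ends
  of `e`, the variance of `B` is smaller by a factor of order `n` than the asserted order
  (`bernVar_shortcutPaths_le_varianceOrder`), for all `p` at once.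
* For `F` the mean of `D_e F` is explicit, `2 (n - 2) p ((n - 3) (1 - 2 p²) + 4)`, which is the
  source of the factor `(1 - √2 p)²`. The fluctuations of `D_e F` are of lower order because only
  pairs of 4-cycles through `e` that share a second arc are correlated. This gives the upper bound
  (`bernVar_pairsMinusCycles_le`).
* The lower bound (`varianceOrder_le_bernVar_pairsMinusCycles`) combines three estimates: the
  first-order coefficients give the leading term up to an error of order `n⁴ p³ (1 - p)`; the
  second-order coefficients, averaged over all pairs of arcs, give `n⁴ p²` for small `p`; and the
  second-order coefficients of pairs of arcs that share a node, each of which lies in about `n`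
  4-cycles, give `n⁵` for `p` away from `0` and `1`.

The resulting bounds have absolute constants and hold for all `p` (`sepEdgeVariance_bounds`), so
that the asymptotic statements follow by comparing the three terms of the order of magnitude.
-/

/-! ### Functions of a random subset -/

section RandomSubset

variable {ι : Type*}

/-- The expectation of `f S`, where `S` is a random subset of `U` that contains each element of `U`
independently with probability `p`. -/
noncomputable def bernExp (p : ℝ) (U : Finset ι) (f : Finset ι → ℝ) : ℝ :=
  ∑ S ∈ U.powerset, p ^ S.card * (1 - p) ^ (U.card - S.card) * f S

/-- The variance of `f S`, where `S` is a random subset of `U` as in `bernExp`. -/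
noncomputable def bernVar (p : ℝ) (U : Finset ι) (f : Finset ι → ℝ) : ℝ :=
  bernExp p U (fun S => f S ^ 2) - bernExp p U f ^ 2

variable {p : ℝ} {U : Finset ι}

lemma bernExp_congr {f g : Finset ι → ℝ} (h : ∀ S ⊆ U, f S = g S) :
    bernExp p U f = bernExp p U g :=
  Finset.sum_congr rfl fun S hS => by rw [h S (Finset.mem_powerset.1 hS)]

lemma bernVar_congr {f g : Finset ι → ℝ} (h : ∀ S ⊆ U, f S = g S) :
    bernVar p U f = bernVar p U g := by
  rw [bernVar, bernVar, bernExp_congr h,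
    bernExp_congr (f := fun S => f S ^ 2) (g := fun S => g S ^ 2) fun S hS => by rw [h S hS]]

lemma bernExp_const (c : ℝ) : bernExp p U (fun _ => c) = c := by
  rw [bernExp, ← Finset.sum_mul, Finset.sum_pow_mul_eq_add_pow]
  simp

lemma bernExp_add (f g : Finset ι → ℝ) :
    bernExp p U (fun S => f S + g S) = bernExp p U f + bernExp p U g := by
  simp only [bernExp, mul_add, Finset.sum_add_distrib]

lemma bernExp_sub (f g : Finset ι → ℝ) :
    bernExp p U (fun S => f S - g S) = bernExp p U f - bernExp p U g := by
  simp only [bernExp, mul_sub, Finset.sum_sub_distrib]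

lemma bernExp_const_mul (c : ℝ) (f : Finset ι → ℝ) :
    bernExp p U (fun S => c * f S) = c * bernExp p U f := by
  simp only [bernExp, Finset.mul_sum]
  exact Finset.sum_congr rfl fun _ _ => by ring

lemma bernExp_sum {τ : Type*} (T : Finset τ) (f : τ → Finset ι → ℝ) :
    bernExp p U (fun S => ∑ t ∈ T, f t S) = ∑ t ∈ T, bernExp p U (f t) := by
  simp only [bernExp, Finset.mul_sum]
  exact Finset.sum_comm

lemma bernExp_mono (hp0 : 0 ≤ p) (hp1 : p ≤ 1) {f g : Finset ι → ℝ} (h : ∀ S ⊆ U, f S ≤ g S) :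
    bernExp p U f ≤ bernExp p U g :=
  Finset.sum_le_sum fun S hS => mul_le_mul_of_nonneg_left (h S (Finset.mem_powerset.1 hS))
    (mul_nonneg (pow_nonneg hp0 _) (pow_nonneg (sub_nonneg.2 hp1) _))

lemma bernVar_eq (f : Finset ι → ℝ) :
    bernVar p U f = bernExp p U (fun S => (f S - bernExp p U f) ^ 2) := by
  have : ∀ S ⊆ U, (f S - bernExp p U f) ^ 2
      = f S ^ 2 - 2 * bernExp p U f * f S + bernExp p U f ^ 2 := fun S _ => by ring
  rw [bernExp_congr this, bernExp_add, bernExp_sub, bernExp_const_mul, bernExp_const, bernVar]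
  ring

lemma bernVar_nonneg (hp0 : 0 ≤ p) (hp1 : p ≤ 1) (f : Finset ι → ℝ) : 0 ≤ bernVar p U f := by
  rw [bernVar_eq]
  simpa [bernExp_const] using
    bernExp_mono (U := U) hp0 hp1 (f := fun _ => 0) fun S _ => sq_nonneg (f S - bernExp p U f)

lemma bernVar_const_mul (c : ℝ) (f : Finset ι → ℝ) :
    bernVar p U (fun S => c * f S) = c ^ 2 * bernVar p U f := by
  simp only [bernVar, mul_pow, bernExp_const_mul]
  ring

lemma bernVar_add_le (hp0 : 0 ≤ p) (hp1 : p ≤ 1) (f g : Finset ι → ℝ) :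
    bernVar p U (fun S => f S + g S) ≤ 2 * bernVar p U f + 2 * bernVar p U g := by
  rw [bernVar_eq f, bernVar_eq g, bernVar_eq fun S => f S + g S, bernExp_add f g,
    ← bernExp_const_mul, ← bernExp_const_mul,
    ← bernExp_add (fun S => 2 * (f S - bernExp p U f) ^ 2)]
  refine bernExp_mono hp0 hp1 fun S _ => ?_
  nlinarith [sq_nonneg ((f S - bernExp p U f) - (g S - bernExp p U g))]

lemma bernVar_sub_le (hp0 : 0 ≤ p) (hp1 : p ≤ 1) (f g : Finset ι → ℝ) :
    bernVar p U (fun S => f S - g S) ≤ 2 * bernVar p U f + 2 * bernVar p U g := by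
  have h := bernVar_add_le (U := U) hp0 hp1 f (fun S => -1 * g S)
  rw [bernVar_const_mul] at h
  simpa [sub_eq_add_neg] using h

lemma sq_bernExp_add_bernVar (f : Finset ι → ℝ) :
    bernExp p U (fun S => f S ^ 2) = bernExp p U f ^ 2 + bernVar p U f := by
  rw [bernVar]; ring

variable [DecidableEq ι]

/-- The discrete derivative of `f` in the direction `e`: the effect on `f` of switching `e` on. -/
def diffAt (e : ι) (f : Finset ι → ℝ) (S : Finset ι) : ℝ :=
  f (insert e S) - f (S.erase e)

/-- The average of `f` over the state of `e`. -/
def avgAt (p : ℝ) (e : ι) (f : Finset ι → ℝ) (S : Finset ι) : ℝ :=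
  (1 - p) * f S + p * f (insert e S)

lemma bernExp_insert {e : ι} (he : e ∉ U) (f : Finset ι → ℝ) :
    bernExp p (insert e U) f = bernExp p U (avgAt p e f) := by
  rw [bernExp, Finset.sum_powerset_insert he, bernExp, ← Finset.sum_add_distrib]
  refine Finset.sum_congr rfl fun S hS => ?_
  have hS' := Finset.mem_powerset.1 hS
  have hc := Finset.card_le_card hS'
  rw [Finset.card_insert_of_notMem he, Finset.card_insert_of_notMem (fun h => he (hS' h)),
    Nat.add_sub_add_right, Nat.succ_sub hc, avgAt, pow_succ, pow_succ]
  ring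

/-- The probability that the random subset contains a given set. -/
lemma bernExp_indicator {A : Finset ι} (hA : A ⊆ U) :
    bernExp p U (fun S => if A ⊆ S then 1 else 0) = p ^ A.card := by
  induction U using Finset.induction_on generalizing A with
  | empty =>
    obtain rfl := Finset.subset_empty.1 hA
    simp [bernExp]
  | insert e U he ih =>
    rw [bernExp_insert he]
    by_cases heA : e ∈ A
    · have h1 : ∀ S ⊆ U, avgAt p e (fun S => if A ⊆ S then (1 : ℝ) else 0) S
          = p * (if A.erase e ⊆ S then 1 else 0) := by
        intro S hS
        have : ¬ A ⊆ S := fun h => he (hS (h heA))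
        simp [avgAt, this, Finset.subset_insert_iff]
      rw [bernExp_congr h1, bernExp_const_mul, ih (Finset.subset_insert_iff.1 hA),
        ← Finset.card_erase_add_one heA, pow_succ]
      ring
    · have hAU : A ⊆ U := (Finset.subset_insert_iff_of_notMem heA).1 hA
      rw [← ih hAU]
      refine bernExp_congr fun S _ => ?_
      simp only [avgAt, Finset.subset_insert_iff_of_notMem heA]
      ring

lemma diffAt_apply_of_notMem {e : ι} (f : Finset ι → ℝ) {S : Finset ι} (he : e ∉ S) :
    diffAt e f S = f (insert e S) - f S := by
  rw [diffAt, Finset.erase_eq_of_notMem he]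

lemma diffAt_comm (a b : ι) (f : Finset ι → ℝ) :
    diffAt a (diffAt b f) = diffAt b (diffAt a f) := by
  rcases eq_or_ne a b with rfl | hab
  · rfl
  funext S
  simp only [diffAt, Finset.erase_insert_of_ne hab, Finset.erase_insert_of_ne hab.symm,
    Finset.insert_comm a b, Finset.erase_right_comm (a := a) (b := b)]
  ring

lemma avgAt_diffAt_self (e : ι) (f : Finset ι → ℝ) : avgAt p e (diffAt e f) = diffAt e f := by
  funext S
  simp only [avgAt, diffAt, Finset.insert_idem, Finset.erase_insert_eq_erase]
  ring

lemma avgAt_diffAt_of_ne {a e : ι} (h : a ≠ e) (f : Finset ι → ℝ) :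
    avgAt p e (diffAt a f) = diffAt a (avgAt p e f) := by
  funext S
  simp only [avgAt, diffAt, Finset.insert_comm e a, Finset.erase_insert_of_ne h.symm]
  ring

/-- Conditioning on all elements but `e`: the law of total variance. -/
lemma bernVar_insert {e : ι} (he : e ∉ U) (f : Finset ι → ℝ) :
    bernVar p (insert e U) f
      = bernVar p U (avgAt p e f) + p * (1 - p) * bernExp p U (fun S => diffAt e f S ^ 2) := by
  rw [bernVar, bernVar, bernExp_insert he, bernExp_insert he, ← bernExp_const_mul]
  have : ∀ S ⊆ U, avgAt p e (fun S => f S ^ 2) S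
      = avgAt p e f S ^ 2 + p * (1 - p) * diffAt e f S ^ 2 := by
    intro S hS
    rw [diffAt_apply_of_notMem f fun h => he (hS h)]
    simp only [avgAt]
    ring
  rw [bernExp_congr this, bernExp_add]
  ring

/-- The Efron–Stein inequality. -/
lemma bernVar_le_sum_diffAt (hp0 : 0 ≤ p) (hp1 : p ≤ 1) (f : Finset ι → ℝ) :
    bernVar p U f ≤ p * (1 - p) * ∑ e ∈ U, bernExp p U (fun S => diffAt e f S ^ 2) := by
  have hpq : 0 ≤ p * (1 - p) := mul_nonneg hp0 (sub_nonneg.2 hp1)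
  induction U using Finset.induction_on generalizing f with
  | empty => simp [bernVar, bernExp]
  | insert e U he ih =>
    rw [bernVar_insert he, Finset.sum_insert he, mul_add, add_comm (p * (1 - p) * _)]
    refine add_le_add ((ih _).trans ?_) (mul_le_mul_of_nonneg_left (le_of_eq ?_) hpq)
    · refine mul_le_mul_of_nonneg_left (Finset.sum_le_sum fun a ha => ?_) hpq
      rw [bernExp_insert he, ← avgAt_diffAt_of_ne (ne_of_mem_of_not_mem ha he)]
      refine bernExp_mono hp0 hp1 fun S _ => ?_
      simp only [avgAt]
      nlinarith [mul_nonneg hpq (sq_nonneg (diffAt a f S - diffAt a f (insert e S)))]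
    · rw [bernExp_insert he]
      refine bernExp_congr fun S hS => ?_
      simp only [avgAt, diffAt, Finset.insert_idem, Finset.erase_insert_eq_erase]
      ring

/-- Bessel's inequality for the first-order part of the Fourier–Walsh expansion of `f`. -/
lemma sum_sq_bernExp_diffAt_le (hp0 : 0 ≤ p) (hp1 : p ≤ 1) (f : Finset ι → ℝ) :
    p * (1 - p) * ∑ e ∈ U, bernExp p U (diffAt e f) ^ 2 ≤ bernVar p U f := by
  have hpq : 0 ≤ p * (1 - p) := mul_nonneg hp0 (sub_nonneg.2 hp1)
  induction U using Finset.induction_on generalizing f with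
  | empty => simp [bernVar, bernExp]
  | insert e U he ih =>
    rw [bernVar_insert he, Finset.sum_insert he, mul_add, add_comm (p * (1 - p) * _)]
    refine add_le_add (le_trans (le_of_eq ?_) (ih _)) (mul_le_mul_of_nonneg_left ?_ hpq)
    · congr 1
      refine Finset.sum_congr rfl fun a ha => ?_
      rw [bernExp_insert he, avgAt_diffAt_of_ne (ne_of_mem_of_not_mem ha he)]
    · rw [bernExp_insert he, avgAt_diffAt_self, sq_bernExp_add_bernVar]
      exact le_add_of_nonneg_right (bernVar_nonneg hp0 hp1 _)

/-- Bessel's inequality for the second-order part of the Fourier–Walsh expansion of `f`. -/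
lemma sum_sq_bernExp_diffAt_diffAt_le (hp0 : 0 ≤ p) (hp1 : p ≤ 1) (f : Finset ι → ℝ) :
    (p * (1 - p)) ^ 2 / 2 * ∑ x ∈ U.offDiag, bernExp p U (diffAt x.1 (diffAt x.2 f)) ^ 2
      ≤ bernVar p U f := by
  have hpq : 0 ≤ p * (1 - p) := mul_nonneg hp0 (sub_nonneg.2 hp1)
  induction U using Finset.induction_on generalizing f with
  | empty => simp [bernVar, bernExp]
  | insert e U he ih =>
    -- The derivative at `e` does not depend on the state of `e`, so `e` may be dropped from the
    -- ground set.
    have key : ∀ a, bernExp p (insert e U) (diffAt a (diffAt e f))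
        = bernExp p U (diffAt a (diffAt e f)) := fun a => by
      rw [bernExp_insert he, diffAt_comm, avgAt_diffAt_self]
    have hd1 : Disjoint U.offDiag ({e} ×ˢ U) := by
      rw [Finset.disjoint_left]
      rintro ⟨a, b⟩ h1 h2
      simp only [Finset.mem_offDiag, Finset.mem_product, Finset.mem_singleton] at h1 h2
      exact he (h2.1 ▸ h1.1)
    have hd2 : Disjoint (U.offDiag ∪ {e} ×ˢ U) (U ×ˢ {e}) := by
      rw [Finset.disjoint_left]
      rintro ⟨a, b⟩ h1 h2
      simp only [Finset.mem_union, Finset.mem_offDiag, Finset.mem_product,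
        Finset.mem_singleton] at h1 h2
      rcases h1 with h1 | h1
      · exact he (h2.2 ▸ h1.2.1)
      · exact he (h1.1 ▸ h2.1)
    rw [Finset.offDiag_insert he, Finset.sum_union hd2, Finset.sum_union hd1,
      Finset.sum_product, Finset.sum_product, Finset.sum_singleton]
    simp only [Finset.sum_singleton, diffAt_comm e, key]
    have h1 : ∑ x ∈ U.offDiag, bernExp p (insert e U) (diffAt x.1 (diffAt x.2 f)) ^ 2
        = ∑ x ∈ U.offDiag, bernExp p U (diffAt x.1 (diffAt x.2 (avgAt p e f))) ^ 2 := by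
      refine Finset.sum_congr rfl fun x hx => ?_
      rw [Finset.mem_offDiag] at hx
      rw [bernExp_insert he, avgAt_diffAt_of_ne (ne_of_mem_of_not_mem hx.1 he),
        avgAt_diffAt_of_ne (ne_of_mem_of_not_mem hx.2.1 he)]
    rw [h1, bernVar_insert he, sq_bernExp_add_bernVar]
    have h2 := ih (avgAt p e f)
    have h3 := mul_le_mul_of_nonneg_left
      (sum_sq_bernExp_diffAt_le (U := U) hp0 hp1 (diffAt e f)) hpq
    have h4 : 0 ≤ p * (1 - p) * bernExp p U (diffAt e f) ^ 2 := by positivity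
    nlinarith

end RandomSubset

/-! ### Counting the members of a family contained in a random subset -/

section FamilyCount

variable {ι τ : Type*} [DecidableEq ι]

/-- The number of indices `t ∈ T` such that the set `A t` is contained in `S`. -/
noncomputable def familyCount (T : Finset τ) (A : τ → Finset ι) (S : Finset ι) : ℝ :=
  ∑ t ∈ T, if A t ⊆ S then 1 else 0

variable {p : ℝ} {U : Finset ι} {T : Finset τ} {A : τ → Finset ι}

lemma diffAt_familyCount (e : ι) :
    diffAt e (familyCount T A)
      = familyCount {t ∈ T | e ∈ A t} (fun t => (A t).erase e) := by
  funext S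
  rw [diffAt, familyCount, familyCount, familyCount, ← Finset.sum_sub_distrib, Finset.sum_filter]
  refine Finset.sum_congr rfl fun t _ => ?_
  by_cases he : e ∈ A t
  · simp [he, Finset.subset_insert_iff, Finset.subset_erase]
  · simp [he, Finset.subset_insert_iff_of_notMem, Finset.subset_erase]

lemma bernExp_familyCount {k : ℕ} (hA : ∀ t ∈ T, A t ⊆ U) (hk : ∀ t ∈ T, (A t).card = k) :
    bernExp p U (familyCount T A) = T.card * p ^ k := by
  unfold familyCount
  rw [bernExp_sum, Finset.sum_congr rfl fun t ht => (bernExp_indicator (hA t ht)).trans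
    (by rw [hk t ht])]
  simp

/-- Only pairs of members that meet contribute to the variance of the count. -/
lemma bernVar_familyCount_le (hp0 : 0 ≤ p) (hp1 : p ≤ 1) {k : ℕ} (hA : ∀ t ∈ T, A t ⊆ U)
    (hk : ∀ t ∈ T, (A t).card = k) :
    bernVar p U (familyCount T A)
      ≤ ∑ t ∈ T, (Finset.card {s ∈ T | ¬ Disjoint (A t) (A s)} : ℝ) * p ^ k := by
  have h1 : ∀ S ⊆ U, familyCount T A S ^ 2
      = ∑ t ∈ T, ∑ s ∈ T, if A t ∪ A s ⊆ S then (1 : ℝ) else 0 := by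
    intro S _
    rw [sq, familyCount, Finset.sum_mul_sum]
    refine Finset.sum_congr rfl fun t _ => Finset.sum_congr rfl fun s _ => ?_
    by_cases h1 : A t ⊆ S <;> by_cases h2 : A s ⊆ S <;> simp [Finset.union_subset_iff, h1, h2]
  rw [bernVar, bernExp_congr h1, bernExp_familyCount hA hk, bernExp_sum]
  have h2 : ((T.card : ℝ) * p ^ k) ^ 2 = ∑ t ∈ T, ∑ s ∈ T, p ^ k * p ^ k := by
    simp only [Finset.sum_const, nsmul_eq_mul]; ring
  rw [h2, ← Finset.sum_sub_distrib]
  refine Finset.sum_le_sum fun t ht => ?_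
  rw [bernExp_sum, ← Finset.sum_sub_distrib, Finset.card_filter, Nat.cast_sum, Finset.sum_mul]
  refine Finset.sum_le_sum fun s hs => ?_
  rw [bernExp_indicator (Finset.union_subset (hA t ht) (hA s hs))]
  by_cases hd : Disjoint (A t) (A s)
  · rw [Finset.card_union_of_disjoint hd, hk t ht, hk s hs, pow_add]
    simp [hd]
  · have : p ^ (A t ∪ A s).card ≤ p ^ k :=
      pow_le_pow_of_le_one hp0 hp1 (hk t ht ▸ Finset.card_le_card Finset.subset_union_left)
    have h3 : 0 ≤ p ^ k * p ^ k := by positivity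
    simp only [hd, not_false_eq_true, if_true, Nat.cast_one, one_mul]
    linarith

lemma bernExp_diffAt_familyCount {k : ℕ} (hA : ∀ t ∈ T, A t ⊆ U)
    (hk : ∀ t ∈ T, (A t).card = k + 1) (e : ι) :
    bernExp p U (diffAt e (familyCount T A)) = (Finset.card {t ∈ T | e ∈ A t} : ℝ) * p ^ k := by
  rw [diffAt_familyCount]
  refine bernExp_familyCount (fun t ht => ?_) fun t ht => ?_
  · exact (Finset.erase_subset _ _).trans (hA t (Finset.mem_filter.1 ht).1)
  · rw [Finset.mem_filter] at ht
    rw [Finset.card_erase_of_mem ht.2, hk t ht.1, Nat.add_sub_cancel]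

lemma bernExp_diffAt_diffAt_familyCount {k : ℕ} (hA : ∀ t ∈ T, A t ⊆ U)
    (hk : ∀ t ∈ T, (A t).card = k + 2) {a b : ι} (hab : a ≠ b) :
    bernExp p U (diffAt a (diffAt b (familyCount T A)))
      = (Finset.card {t ∈ T | a ∈ A t ∧ b ∈ A t} : ℝ) * p ^ k := by
  rw [diffAt_familyCount, bernExp_diffAt_familyCount (k := k), Finset.filter_filter]
  · congr 3
    refine Finset.filter_congr fun t _ => ?_
    rw [Finset.mem_erase]
    tauto
  · exact fun t ht => (Finset.erase_subset _ _).trans (hA t (Finset.mem_filter.1 ht).1)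
  · intro t ht
    rw [Finset.mem_filter] at ht
    rw [Finset.card_erase_of_mem ht.2, hk t ht.1]
    rfl

/-- The variance of a derivative of the count, when at most `N₁` members contain `e` and at most
`N₂` members contain `e` and any other given element. -/
lemma bernVar_diffAt_familyCount_le (hp0 : 0 ≤ p) (hp1 : p ≤ 1) {k : ℕ} (hA : ∀ t ∈ T, A t ⊆ U)
    (hk : ∀ t ∈ T, (A t).card = k + 1) (e : ι) {N₁ N₂ : ℝ} (hN₂0 : 0 ≤ N₂)
    (hN₁ : (Finset.card {t ∈ T | e ∈ A t} : ℝ) ≤ N₁)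
    (hN₂ : ∀ a, a ≠ e → (Finset.card {t ∈ T | e ∈ A t ∧ a ∈ A t} : ℝ) ≤ N₂) :
    bernVar p U (diffAt e (familyCount T A)) ≤ N₁ * (k * N₂) * p ^ k := by
  have hk' : ∀ t ∈ ({t ∈ T | e ∈ A t} : Finset τ), ((A t).erase e).card = k := by
    intro t ht
    rw [Finset.mem_filter] at ht
    rw [Finset.card_erase_of_mem ht.2, hk t ht.1, Nat.add_sub_cancel]
  rw [diffAt_familyCount]
  refine (bernVar_familyCount_le hp0 hp1 (fun t ht => (Finset.erase_subset _ _).trans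
    (hA t (Finset.mem_filter.1 ht).1)) hk').trans ?_
  have h1 : ∀ t ∈ ({t ∈ T | e ∈ A t} : Finset τ),
      (Finset.card {s ∈ ({t ∈ T | e ∈ A t} : Finset τ) |
        ¬ Disjoint ((A t).erase e) ((A s).erase e)} : ℝ) * p ^ k ≤ k * N₂ * p ^ k := by
    intro t ht
    refine mul_le_mul_of_nonneg_right ?_ (pow_nonneg hp0 k)
    classical
    have hsub : ({s ∈ ({t ∈ T | e ∈ A t} : Finset τ) |
        ¬ Disjoint ((A t).erase e) ((A s).erase e)} : Finset τ)
        ⊆ ((A t).erase e).biUnion fun a => {s ∈ T | e ∈ A s ∧ a ∈ A s} := by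
      intro s hs
      simp only [Finset.mem_filter, Finset.not_disjoint_iff] at hs
      obtain ⟨⟨hs1, hs2⟩, a, ha1, ha2⟩ := hs
      rw [Finset.mem_biUnion]
      exact ⟨a, ha1, by simp [hs1, hs2, Finset.mem_of_mem_erase ha2]⟩
    calc (Finset.card {s ∈ ({t ∈ T | e ∈ A t} : Finset τ) |
          ¬ Disjoint ((A t).erase e) ((A s).erase e)} : ℝ)
        ≤ ∑ a ∈ (A t).erase e, (Finset.card {s ∈ T | e ∈ A s ∧ a ∈ A s} : ℝ) := by
          exact_mod_cast (Finset.card_le_card hsub).trans Finset.card_biUnion_le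
      _ ≤ ∑ a ∈ (A t).erase e, N₂ :=
          Finset.sum_le_sum fun a ha => hN₂ a (Finset.ne_of_mem_erase ha)
      _ = k * N₂ := by rw [Finset.sum_const, hk' t ht, nsmul_eq_mul]
  refine (Finset.sum_le_sum h1).trans ?_
  rw [Finset.sum_const, nsmul_eq_mul, ← mul_assoc]
  have : 0 ≤ k * N₂ := by positivity
  exact mul_le_mul_of_nonneg_right (mul_le_mul_of_nonneg_right hN₁ this) (pow_nonneg hp0 k)

end FamilyCount

/-! ### Labelled 4-cycles -/

section CycleFamily

variable {V : Type*} [Fintype V] [DecidableEq V]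

variable (V) in
/-- The pairs of distinct nodes: the possible arcs of a graph on `V`. -/
def arcs : Finset (Sym2 V) := {e | ¬ e.IsDiag}

variable (V) in
/-- The quadruples `((i, j), (k, l))` of pairwise distinct nodes, each read as the 4-cycle
`i j k l`. -/
def cycles : Finset ((V × V) × (V × V)) :=
  {t | t.1.1 ≠ t.1.2 ∧ t.1.1 ≠ t.2.1 ∧ t.1.1 ≠ t.2.2 ∧ t.1.2 ≠ t.2.1 ∧ t.1.2 ≠ t.2.2 ∧
    t.2.1 ≠ t.2.2}

/-- The arcs of the 4-cycle `i j k l`. -/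
def cycleArcs (t : (V × V) × (V × V)) : Finset (Sym2 V) :=
  {s(t.1.1, t.1.2), s(t.1.2, t.2.1), s(t.2.1, t.2.2), s(t.2.2, t.1.1)}

lemma card_arcs : ((arcs V).card : ℝ) = Fintype.card V * (Fintype.card V - 1) / 2 := by
  have h := Sym2.card_subtype_not_diag (α := V)
  rw [Fintype.card_subtype] at h
  rw [arcs, h, Nat.cast_choose_two]

lemma cycleArcs_subset {t : (V × V) × (V × V)} (ht : t ∈ cycles V) : cycleArcs t ⊆ arcs V := by
  simp only [cycles, Finset.mem_filter, Finset.mem_univ, true_and] at ht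
  obtain ⟨h1, h2, h3, h4, h5, h6⟩ := ht
  intro e he
  simp only [cycleArcs, Finset.mem_insert, Finset.mem_singleton] at he
  rcases he with rfl | rfl | rfl | rfl <;> simp [arcs, *, h3.symm]

lemma card_cycleArcs {t : (V × V) × (V × V)} (ht : t ∈ cycles V) : (cycleArcs t).card = 4 := by
  obtain ⟨⟨i, j⟩, ⟨k, l⟩⟩ := t
  simp only [cycles, Finset.mem_filter, Finset.mem_univ, true_and] at ht
  obtain ⟨h1, h2, h3, h4, h5, h6⟩ := ht
  rw [cycleArcs, Finset.card_insert_of_notMem, Finset.card_insert_of_notMem,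
    Finset.card_insert_of_notMem, Finset.card_singleton]
  all_goals
    simp only [Finset.mem_insert, Finset.mem_singleton, Sym2.eq_iff]
    grind

/-- The number of 4-cycles whose first arc is `s(u, v)`. -/
lemma card_cycles_first {u v : V} (huv : u ≠ v) :
    (Finset.card {t ∈ cycles V | s(t.1.1, t.1.2) = s(u, v)} : ℝ)
      = 2 * (Fintype.card V - 2) * (Fintype.card V - 3) := by
  have h : ({t ∈ cycles V | s(t.1.1, t.1.2) = s(u, v)} : Finset _)
      = {(u, v), (v, u)} ×ˢ (Finset.univ \ {u, v}).offDiag := by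
    ext ⟨⟨i, j⟩, ⟨k, l⟩⟩
    simp only [cycles, Finset.mem_filter, Finset.mem_univ, true_and, Sym2.eq_iff,
      Finset.mem_product, Finset.mem_insert, Finset.mem_singleton, Prod.mk.injEq,
      Finset.mem_offDiag, Finset.mem_sdiff]
    constructor
    · rintro ⟨⟨h1, h2, h3, h4, h5, h6⟩, ⟨rfl, rfl⟩ | ⟨rfl, rfl⟩⟩ <;>
        simp [*, Ne.symm, ne_comm]
    · rintro ⟨⟨rfl, rfl⟩ | ⟨rfl, rfl⟩, h⟩ <;> grind
  have hc : ((Finset.univ \ {u, v} : Finset V).card : ℝ) = Fintype.card V - 2 := by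
    have := Finset.card_sdiff_add_card_eq_card (Finset.subset_univ ({u, v} : Finset V))
    rw [Finset.card_pair huv, Finset.card_univ] at this
    rw [← this]; push_cast; ring
  have hle : (Finset.univ \ {u, v} : Finset V).card
      ≤ (Finset.univ \ {u, v} : Finset V).card * (Finset.univ \ {u, v} : Finset V).card :=
    Nat.le_mul_self _
  rw [h, Finset.card_product, Finset.card_pair (by simp [huv]), Finset.offDiag_card]
  push_cast [Nat.cast_sub hle]
  rw [hc]
  ring

/-- Rotation of 4-cycles. -/
def rotateCycle : (V × V) × (V × V) ≃ (V × V) × (V × V) where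
  toFun t := ((t.1.2, t.2.1), (t.2.2, t.1.1))
  invFun t := ((t.2.2, t.1.1), (t.1.2, t.2.1))
  left_inv _ := rfl
  right_inv _ := rfl

lemma rotateCycle_mem (t : (V × V) × (V × V)) : rotateCycle t ∈ cycles V ↔ t ∈ cycles V := by
  simp only [cycles, rotateCycle, Equiv.coe_fn_mk, Finset.mem_filter, Finset.mem_univ, true_and]
  grind

lemma sum_cycles_rotate (f : (V × V) × (V × V) → ℝ) :
    ∑ t ∈ cycles V, f (rotateCycle t) = ∑ t ∈ cycles V, f t :=
  Finset.sum_equiv rotateCycle (fun t => (rotateCycle_mem t).symm) fun _ _ => rfl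

/-- The number of labelled 4-cycles through a given arc. -/
lemma card_cycles_mem {e : Sym2 V} (he : e ∈ arcs V) :
    (Finset.card {t ∈ cycles V | e ∈ cycleArcs t} : ℝ)
      = 8 * (Fintype.card V - 2) * (Fintype.card V - 3) := by
  let f : (V × V) × (V × V) → ℝ := fun t => if s(t.1.1, t.1.2) = e then 1 else 0
  have h0 : ∑ t ∈ cycles V, f t = 2 * (Fintype.card V - 2) * (Fintype.card V - 3) := by
    induction e with
    | _ u v =>
      rw [← card_cycles_first (u := u) (v := v) (by simpa [arcs] using he)]
      rw [Finset.card_filter, Nat.cast_sum]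
      simp only [f, Nat.cast_ite, Nat.cast_one, Nat.cast_zero]
  have h1 := sum_cycles_rotate f
  have h2 := sum_cycles_rotate fun t => f (rotateCycle t)
  have h3 := sum_cycles_rotate fun t => f (rotateCycle (rotateCycle t))
  have key : ∀ t ∈ cycles V, (if e ∈ cycleArcs t then (1 : ℝ) else 0)
      = f t + f (rotateCycle t) + f (rotateCycle (rotateCycle t))
        + f (rotateCycle (rotateCycle (rotateCycle t))) := by
    rintro ⟨⟨i, j⟩, ⟨k, l⟩⟩ ht
    simp only [cycles, Finset.mem_filter, Finset.mem_univ, true_and] at ht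
    simp only [f, rotateCycle, Equiv.coe_fn_mk, cycleArcs, Finset.mem_insert,
      Finset.mem_singleton]
    have e1 : s(i, j) ≠ s(j, k) := by rw [Ne, Sym2.eq_iff]; grind
    have e2 : s(i, j) ≠ s(k, l) := by rw [Ne, Sym2.eq_iff]; grind
    have e3 : s(i, j) ≠ s(l, i) := by rw [Ne, Sym2.eq_iff]; grind
    have e4 : s(j, k) ≠ s(k, l) := by rw [Ne, Sym2.eq_iff]; grind
    have e5 : s(j, k) ≠ s(l, i) := by rw [Ne, Sym2.eq_iff]; grind
    have e6 : s(k, l) ≠ s(l, i) := by rw [Ne, Sym2.eq_iff]; grind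
    by_cases h : e = s(i, j) ∨ e = s(j, k) ∨ e = s(k, l) ∨ e = s(l, i)
    · rw [if_pos h]
      rcases h with rfl | rfl | rfl | rfl
      · rw [if_pos rfl, if_neg e1.symm, if_neg e2.symm, if_neg e3.symm]; norm_num
      · rw [if_neg e1, if_pos rfl, if_neg e4.symm, if_neg e5.symm]; norm_num
      · rw [if_neg e2, if_neg e4, if_pos rfl, if_neg e6.symm]; norm_num
      · rw [if_neg e3, if_neg e5, if_neg e6, if_pos rfl]; norm_num
    · rw [if_neg h]
      simp only [not_or] at h
      rw [if_neg (Ne.symm h.1), if_neg (Ne.symm h.2.1), if_neg (Ne.symm h.2.2.1),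
        if_neg (Ne.symm h.2.2.2)]
      norm_num
  rw [Finset.card_filter, Nat.cast_sum]
  simp only [Nat.cast_ite, Nat.cast_one, Nat.cast_zero]
  rw [Finset.sum_congr rfl key]
  simp only [Finset.sum_add_distrib]
  linarith

lemma card_cycles :
    ((cycles V).card : ℝ) = Fintype.card V * (Fintype.card V - 1) * (Fintype.card V - 2)
      * (Fintype.card V - 3) := by
  have h := Finset.sum_card_bipartiteAbove_eq_sum_card_bipartiteBelow
    (s := arcs V) (t := cycles V) (fun e t => e ∈ cycleArcs t)
  have h1 : ∀ t ∈ cycles V, ((arcs V).bipartiteBelow (fun e t => e ∈ cycleArcs t) t).card = 4 := by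
    intro t ht
    rw [← card_cycleArcs ht]
    congr 1
    ext e
    simp only [Finset.mem_bipartiteBelow]
    exact ⟨fun h => h.2, fun h => ⟨cycleArcs_subset ht h, h⟩⟩
  rw [Finset.sum_congr rfl h1, Finset.sum_const, smul_eq_mul] at h
  have h2 : ((∑ e ∈ arcs V, ((cycles V).bipartiteAbove (fun e t => e ∈ cycleArcs t) e).card : ℕ)
      : ℝ) = (arcs V).card * (8 * (Fintype.card V - 2) * (Fintype.card V - 3)) := by
    rw [Nat.cast_sum, ← nsmul_eq_mul, ← Finset.sum_const]
    exact Finset.sum_congr rfl fun e he => card_cycles_mem he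
  rw [h, card_arcs] at h2
  push_cast at h2
  linarith

/-- Two distinct arcs have at least three nodes in common with a 4-cycle through them, so only one
node of the cycle is free. -/
lemma card_cycles_mem_mem_le {e e' : Sym2 V} (hne : e' ≠ e) :
    (Finset.card {t ∈ cycles V | e ∈ cycleArcs t ∧ e' ∈ cycleArcs t} : ℝ)
      ≤ 256 * Fintype.card V := by
  let W : Finset V := e.toFinset ∪ e'.toFinset
  have hW : W.card ≤ 4 := by
    have h : ∀ a : Sym2 V, a.toFinset.card ≤ 2 := fun a => by
      rw [Sym2.card_toFinset]; split_ifs <;> omega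
    exact (Finset.card_union_le _ _).trans (add_le_add (h e) (h e'))
  -- All positions but one are nodes of `e` or `e'`.
  let N : Finset ((V × V) × (V × V)) :=
    (Finset.univ ×ˢ W) ×ˢ (W ×ˢ W) ∪ (W ×ˢ Finset.univ) ×ˢ (W ×ˢ W) ∪
      (W ×ˢ W) ×ˢ (Finset.univ ×ˢ W) ∪ (W ×ˢ W) ×ˢ (W ×ˢ Finset.univ)
  have hN : N.card ≤ 256 * Fintype.card V := by
    have h3 : W.card * (W.card * W.card) ≤ 64 :=
      (Nat.mul_le_mul hW (Nat.mul_le_mul hW hW)).trans (by norm_num)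
    have h4 := Nat.mul_le_mul_right (Fintype.card V) h3
    refine (Finset.card_union_le _ _).trans ?_
    refine (Nat.add_le_add_right (Finset.card_union_le _ _) _).trans ?_
    refine (Nat.add_le_add_right (Nat.add_le_add_right (Finset.card_union_le _ _) _) _).trans ?_
    simp only [Finset.card_product, Finset.card_univ]
    nlinarith
  have hsub : ({t ∈ cycles V | e ∈ cycleArcs t ∧ e' ∈ cycleArcs t} : Finset _) ⊆ N := by
    rintro ⟨⟨i, j⟩, ⟨k, l⟩⟩ ht
    have hm : ∀ a b : V, e = s(a, b) → a ∈ W ∧ b ∈ W := by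
      rintro a b rfl; simp [W]
    have hm' : ∀ a b : V, e' = s(a, b) → a ∈ W ∧ b ∈ W := by
      rintro a b rfl; simp [W]
    simp only [Finset.mem_filter, cycleArcs, Finset.mem_insert, Finset.mem_singleton] at ht
    obtain ⟨-, h1, h2⟩ := ht
    simp only [N, Finset.mem_union, Finset.mem_product, Finset.mem_univ, true_and, and_true]
    rcases h1 with h1 | h1 | h1 | h1 <;> rcases h2 with h2 | h2 | h2 | h2 <;>
      first
      | exact absurd (h2.trans h1.symm) hne
      | (have := hm _ _ h1; have := hm' _ _ h2; tauto)
  exact_mod_cast (Finset.card_le_card hsub).trans hN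

end CycleFamily

/-! ### The polynomial part of the edge count -/

section PolynomialPart

lemma sq_sum_bernExp_diffAt_diffAt_le {ι : Type*} [DecidableEq ι] {p : ℝ} {U : Finset ι}
    (hp0 : 0 ≤ p) (hp1 : p ≤ 1) (f : Finset ι → ℝ) {P : Finset (ι × ι)} (hP : P ⊆ U.offDiag) :
    (p * (1 - p)) ^ 2 / 2 * (∑ x ∈ P, bernExp p U (diffAt x.1 (diffAt x.2 f))) ^ 2
      ≤ P.card * bernVar p U f := by
  have h1 := sum_sq_bernExp_diffAt_diffAt_le (U := U) hp0 hp1 f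
  have h2 : ∑ x ∈ P, bernExp p U (diffAt x.1 (diffAt x.2 f)) ^ 2
      ≤ ∑ x ∈ U.offDiag, bernExp p U (diffAt x.1 (diffAt x.2 f)) ^ 2 :=
    Finset.sum_le_sum_of_subset_of_nonneg hP fun _ _ _ => sq_nonneg _
  have h3 := sq_sum_le_card_mul_sum_sq (s := P)
    (f := fun x => bernExp p U (diffAt x.1 (diffAt x.2 f)))
  have h4 : 0 ≤ (p * (1 - p)) ^ 2 / 2 := by positivity
  calc _ ≤ (p * (1 - p)) ^ 2 / 2 * (P.card * ∑ x ∈ P,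
        bernExp p U (diffAt x.1 (diffAt x.2 f)) ^ 2) := mul_le_mul_of_nonneg_left h3 h4
    _ = P.card * ((p * (1 - p)) ^ 2 / 2 * ∑ x ∈ P,
        bernExp p U (diffAt x.1 (diffAt x.2 f)) ^ 2) := by ring
    _ ≤ _ := mul_le_mul_of_nonneg_left ((mul_le_mul_of_nonneg_left h2 h4).trans h1)
        (Nat.cast_nonneg _)

lemma diffAt_lin {ι : Type*} [DecidableEq ι] (e : ι) (a b : ℝ) (f g : Finset ι → ℝ) :
    diffAt e (fun S => a * f S - b * g S) = fun S => a * diffAt e f S - b * diffAt e g S := by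
  funext S
  simp only [diffAt]
  ring

lemma bernExp_lin {ι : Type*} {p : ℝ} {U : Finset ι} (a b : ℝ) (f g : Finset ι → ℝ) :
    bernExp p U (fun S => a * f S - b * g S) = a * bernExp p U f - b * bernExp p U g := by
  rw [bernExp_sub, bernExp_const_mul, bernExp_const_mul]

/-- The two arcs of a pair of arcs. -/
def pairArcs {ι : Type*} [DecidableEq ι] (x : ι × ι) : Finset ι := {x.1, x.2}

section Pairs

variable {ι : Type*} [DecidableEq ι] {U : Finset ι}

lemma pairArcs_subset {x : ι × ι} (hx : x ∈ U.offDiag) : pairArcs x ⊆ U := by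
  rw [Finset.mem_offDiag] at hx
  intro a ha
  simp only [pairArcs, Finset.mem_insert, Finset.mem_singleton] at ha
  rcases ha with rfl | rfl
  exacts [hx.1, hx.2.1]

lemma card_pairArcs {x : ι × ι} (hx : x ∈ U.offDiag) : (pairArcs x).card = 2 :=
  Finset.card_pair (Finset.mem_offDiag.1 hx).2.2

lemma card_pairs_mem {e : ι} (he : e ∈ U) :
    (Finset.card {x ∈ U.offDiag | e ∈ pairArcs x} : ℝ) = 2 * (U.card - 1) := by
  have h : ({x ∈ U.offDiag | e ∈ pairArcs x} : Finset _)
      = {e} ×ˢ U.erase e ∪ U.erase e ×ˢ {e} := by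
    ext ⟨a, b⟩
    simp only [pairArcs, Finset.mem_filter, Finset.mem_offDiag, Finset.mem_union,
      Finset.mem_product, Finset.mem_insert, Finset.mem_singleton, Finset.mem_erase]
    grind
  have hd : Disjoint ({e} ×ˢ U.erase e) (U.erase e ×ˢ {e}) := by
    rw [Finset.disjoint_left]
    rintro ⟨a, b⟩ h1 h2
    simp only [Finset.mem_product, Finset.mem_singleton, Finset.mem_erase] at h1 h2
    exact h1.2.1 h2.2
  rw [h, Finset.card_union_of_disjoint hd, Finset.card_product, Finset.card_product,
    Finset.card_singleton, Nat.cast_add, Nat.cast_mul, Nat.cast_mul,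
    Finset.cast_card_erase_of_mem he]
  push_cast
  ring

lemma card_pairs_mem_mem {a b : ι} (ha : a ∈ U) (hb : b ∈ U) (hab : a ≠ b) :
    Finset.card {x ∈ U.offDiag | a ∈ pairArcs x ∧ b ∈ pairArcs x} = 2 := by
  have h : ({x ∈ U.offDiag | a ∈ pairArcs x ∧ b ∈ pairArcs x} : Finset _) = {(a, b), (b, a)} := by
    ext ⟨c, d⟩
    simp only [pairArcs, Finset.mem_filter, Finset.mem_offDiag, Finset.mem_insert,
      Finset.mem_singleton, Prod.mk.injEq]
    grind
  rw [h, Finset.card_pair (by simp [hab])]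

lemma card_pairs_mem_mem_le {a b : ι} (hab : b ≠ a) :
    Finset.card {x ∈ U.offDiag | a ∈ pairArcs x ∧ b ∈ pairArcs x} ≤ 2 := by
  have h : ({x ∈ U.offDiag | a ∈ pairArcs x ∧ b ∈ pairArcs x} : Finset _) ⊆ {(a, b), (b, a)} := by
    rintro ⟨c, d⟩
    simp only [pairArcs, Finset.mem_filter, Finset.mem_offDiag, Finset.mem_insert,
      Finset.mem_singleton, Prod.mk.injEq]
    grind
  exact (Finset.card_le_card h).trans Finset.card_le_two

end Pairs

variable (V : Type*) [Fintype V] [DecidableEq V]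

/-- Four times the number of pairs of arcs in `S`, minus four times the number of 4-cycles in `S`
(both families below are labelled: every pair occurs twice and every 4-cycle eight times). -/
noncomputable def pairsMinusCycles : Finset (Sym2 V) → ℝ :=
  fun S => 2 * familyCount (arcs V).offDiag pairArcs S
    - 1 / 2 * familyCount (cycles V) cycleArcs S

variable {V} {p : ℝ}

/-- The first-order Fourier coefficients. Their leading term vanishes at `p = 1 / √2`. -/
lemma bernExp_diffAt_pairsMinusCycles {e : Sym2 V} (he : e ∈ arcs V) :
    bernExp p (arcs V) (diffAt e (pairsMinusCycles V))
      = 2 * (Fintype.card V - 2) * p * ((Fintype.card V - 3) * (1 - 2 * p ^ 2) + 4) := by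
  unfold pairsMinusCycles
  rw [diffAt_lin, bernExp_lin,
    bernExp_diffAt_familyCount (k := 1) (fun x hx => pairArcs_subset hx)
      (fun x hx => card_pairArcs hx),
    bernExp_diffAt_familyCount (k := 3) (fun t ht => cycleArcs_subset ht)
      (fun t ht => card_cycleArcs ht), card_pairs_mem he, card_cycles_mem he, card_arcs]
  ring

lemma bernExp_diffAt_diffAt_pairsMinusCycles {a b : Sym2 V} (ha : a ∈ arcs V) (hb : b ∈ arcs V)
    (hab : a ≠ b) :
    bernExp p (arcs V) (diffAt a (diffAt b (pairsMinusCycles V)))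
      = 4 - 1 / 2 * ((Finset.card {t ∈ cycles V | a ∈ cycleArcs t ∧ b ∈ cycleArcs t} : ℝ)
        * p ^ 2) := by
  unfold pairsMinusCycles
  rw [diffAt_lin, diffAt_lin, bernExp_lin,
    bernExp_diffAt_diffAt_familyCount (k := 0) (fun x hx => pairArcs_subset hx)
      (fun x hx => card_pairArcs hx) hab,
    bernExp_diffAt_diffAt_familyCount (k := 2) (fun t ht => cycleArcs_subset ht)
      (fun t ht => card_cycleArcs ht) hab, card_pairs_mem_mem ha hb hab]
  norm_num

lemma bernVar_diffAt_pairsMinusCycles_le (hp0 : 0 ≤ p) (hp1 : p ≤ 1)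
    (hn : 4 ≤ (Fintype.card V : ℝ)) {e : Sym2 V} (he : e ∈ arcs V) :
    bernVar p (arcs V) (diffAt e (pairsMinusCycles V))
      ≤ 16 * (Fintype.card V : ℝ) ^ 2 * p + 3072 * (Fintype.card V : ℝ) ^ 3 * p ^ 3 := by
  set n : ℝ := (Fintype.card V : ℝ) with hn'
  have h2 := bernVar_diffAt_familyCount_le (U := arcs V) (T := (arcs V).offDiag) (A := pairArcs)
    hp0 hp1 (k := 1) (fun x hx => pairArcs_subset hx) (fun x hx => card_pairArcs hx) e
    (N₁ := n ^ 2) (N₂ := 2) (by norm_num)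
    (by rw [card_pairs_mem he, card_arcs]; nlinarith)
    (fun a ha => by exact_mod_cast card_pairs_mem_mem_le ha)
  have h4 := bernVar_diffAt_familyCount_le (U := arcs V) (T := cycles V) (A := cycleArcs)
    hp0 hp1 (k := 3) (fun t ht => cycleArcs_subset ht) (fun t ht => card_cycleArcs ht) e
    (N₁ := 8 * n ^ 2) (N₂ := 256 * n) (by positivity)
    (by rw [card_cycles_mem he]; nlinarith)
    (fun a ha => card_cycles_mem_mem_le ha)
  unfold pairsMinusCycles
  rw [diffAt_lin]
  refine (bernVar_sub_le hp0 hp1 _ _).trans ?_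
  rw [bernVar_const_mul, bernVar_const_mul]
  push_cast at h2 h4
  nlinarith

lemma sum_arcs_const (c : ℝ) :
    ∑ _e ∈ arcs V, c = (Fintype.card V : ℝ) * (Fintype.card V - 1) / 2 * c := by
  rw [Finset.sum_const, nsmul_eq_mul, card_arcs]

lemma sqrt_two_bounds : (1.414 : ℝ) < √2 ∧ √2 < 1.415 := by
  constructor
  · rw [Real.lt_sqrt (by norm_num)]; norm_num
  · rw [Real.sqrt_lt' (by norm_num)]; norm_num

lemma one_sub_two_mul_sq_sq (p : ℝ) :
    (1 - 2 * p ^ 2) ^ 2 = (1 - √2 * p) ^ 2 * (1 + √2 * p) ^ 2 := by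
  have h : √2 ^ 2 = 2 := Real.sq_sqrt (by norm_num)
  rw [← mul_pow]
  congr 1
  linear_combination p ^ 2 * h

lemma bernVar_pairsMinusCycles_le (hp0 : 0 ≤ p) (hp1 : p ≤ 1)
    (hn : 4 ≤ (Fintype.card V : ℝ)) :
    bernVar p (arcs V) (pairsMinusCycles V) ≤ 1600 *
      ((Fintype.card V : ℝ) ^ 6 * p ^ 3 * (1 - p) * (1 - √2 * p) ^ 2
        + (Fintype.card V : ℝ) ^ 5 * p ^ 3 * (1 - p)
        + (Fintype.card V : ℝ) ^ 4 * p ^ 2 * (1 - p)) := by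
  have hq : 0 ≤ 1 - p := sub_nonneg.2 hp1
  have hpq : 0 ≤ p * (1 - p) := mul_nonneg hp0 hq
  set n : ℝ := (Fintype.card V : ℝ) with hn'
  set r : ℝ := (1 - √2 * p) ^ 2 with hr
  have hr0 : 0 ≤ r := sq_nonneg _
  have h1 : ∀ e ∈ arcs V, bernExp p (arcs V) (fun S => diffAt e (pairsMinusCycles V) S ^ 2)
      ≤ 4 * n ^ 2 * p ^ 2 * (12 * n ^ 2 * r + 32) + (16 * n ^ 2 * p + 3072 * n ^ 3 * p ^ 3) := by
    intro e he
    rw [sq_bernExp_add_bernVar, bernExp_diffAt_pairsMinusCycles he]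
    refine add_le_add ?_ (bernVar_diffAt_pairsMinusCycles_le hp0 hp1 hn he)
    have h2 : (1 - 2 * p ^ 2) ^ 2 ≤ 6 * r := by
      rw [one_sub_two_mul_sq_sq, mul_comm]
      refine mul_le_mul_of_nonneg_right ?_ hr0
      have h3 : √2 * p ≤ 1.415 := by nlinarith [sqrt_two_bounds]
      have h4 : 0 ≤ √2 * p := by positivity
      nlinarith
    have h5 : ((n - 3) * (1 - 2 * p ^ 2) + 4) ^ 2 ≤ 12 * n ^ 2 * r + 32 := by
      have h6 : ((n - 3) * (1 - 2 * p ^ 2)) ^ 2 ≤ n ^ 2 * (6 * r) := by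
        rw [mul_pow]
        exact mul_le_mul (by nlinarith) h2 (sq_nonneg _) (by positivity)
      nlinarith [sq_nonneg ((n - 3) * (1 - 2 * p ^ 2) - 4)]
    have h7 : (2 * (n - 2) * p) ^ 2 ≤ 4 * n ^ 2 * p ^ 2 := by
      have : (n - 2) ^ 2 ≤ n ^ 2 := by nlinarith
      nlinarith [mul_le_mul_of_nonneg_right this (sq_nonneg p)]
    rw [mul_pow]
    exact mul_le_mul h7 h5 (sq_nonneg _) (by positivity)
  refine (bernVar_le_sum_diffAt hp0 hp1 _).trans ?_
  refine (mul_le_mul_of_nonneg_left (Finset.sum_le_sum h1) hpq).trans ?_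
  rw [sum_arcs_const, ← hn']
  set b : ℝ := 4 * n ^ 2 * p ^ 2 * (12 * n ^ 2 * r + 32)
    + (16 * n ^ 2 * p + 3072 * n ^ 3 * p ^ 3) with hb
  have hb0 : 0 ≤ b := by positivity
  have h8 : n * (n - 1) / 2 * b ≤ n ^ 2 / 2 * b := mul_le_mul_of_nonneg_right (by nlinarith) hb0
  refine (mul_le_mul_of_nonneg_left h8 hpq).trans ?_
  have e1 : p * (1 - p) * (n ^ 2 / 2 * b) = 24 * (n ^ 6 * p ^ 3 * (1 - p) * r)
      + 64 * (n ^ 4 * p ^ 3 * (1 - p)) + 8 * (n ^ 4 * p ^ 2 * (1 - p))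
      + 1536 * (p * (n ^ 5 * p ^ 3 * (1 - p))) := by rw [hb]; ring
  have hB : 0 ≤ n ^ 5 * p ^ 3 * (1 - p) := by positivity
  have hA : 0 ≤ n ^ 6 * p ^ 3 * (1 - p) * r := by positivity
  have hC : 0 ≤ n ^ 4 * p ^ 2 * (1 - p) := by positivity
  have e2 : n ^ 4 * p ^ 3 * (1 - p) ≤ n ^ 5 * p ^ 3 * (1 - p) := by
    have : n ^ 4 ≤ n ^ 5 := pow_le_pow_right₀ (by linarith) (by norm_num)
    gcongr
  have e3 : p * (n ^ 5 * p ^ 3 * (1 - p)) ≤ n ^ 5 * p ^ 3 * (1 - p) := mul_le_of_le_one_left hB hp1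
  rw [e1]
  linarith

/-- The lower bound that the first-order coefficients give. -/
lemma bernVar_pairsMinusCycles_ge_first (hp0 : 0 ≤ p) (hp1 : p ≤ 1)
    (hn : 288 ≤ (Fintype.card V : ℝ)) :
    (Fintype.card V : ℝ) ^ 6 * p ^ 3 * (1 - p) * (1 - √2 * p) ^ 2
      ≤ 24 * bernVar p (arcs V) (pairsMinusCycles V)
        + 128 * ((Fintype.card V : ℝ) ^ 4 * p ^ 3 * (1 - p)) := by
  have hq : 0 ≤ 1 - p := sub_nonneg.2 hp1
  set n : ℝ := (Fintype.card V : ℝ) with hn'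
  set r : ℝ := (1 - √2 * p) ^ 2 with hr
  have hr0 : 0 ≤ r := sq_nonneg _
  have h0 := sum_sq_bernExp_diffAt_le (U := arcs V) hp0 hp1 (pairsMinusCycles V)
  rw [Finset.sum_congr rfl fun e he => by rw [bernExp_diffAt_pairsMinusCycles he],
    sum_arcs_const, ← hn'] at h0
  have h2 : r ≤ (1 - 2 * p ^ 2) ^ 2 := by
    rw [one_sub_two_mul_sq_sq]
    have h4 : 0 ≤ √2 * p := by positivity
    exact le_mul_of_one_le_right hr0 (one_le_pow₀ (by linarith))
  have h5 : n ^ 2 * r / 8 - 16 ≤ ((n - 3) * (1 - 2 * p ^ 2) + 4) ^ 2 := by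
    -- `(x + 4) ^ 2 ≥ x ^ 2 / 2 - 16` separates the leading term from the constant `4`.
    have h6 : n ^ 2 / 4 * r ≤ ((n - 3) * (1 - 2 * p ^ 2)) ^ 2 := by
      rw [mul_pow]
      exact mul_le_mul (by nlinarith) h2 hr0 (sq_nonneg _)
    nlinarith [sq_nonneg ((n - 3) * (1 - 2 * p ^ 2) + 8)]
  have h7 : n ^ 4 / 3 ≤ n * (n - 1) / 2 * (2 * (n - 2)) ^ 2 := by
    have a1 : n ^ 2 / 3 ≤ n * (n - 1) / 2 := by nlinarith
    have a2 : n ^ 2 ≤ (2 * (n - 2)) ^ 2 := by nlinarith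
    calc n ^ 4 / 3 = n ^ 2 / 3 * n ^ 2 := by ring
      _ ≤ _ := mul_le_mul a1 a2 (by positivity) (by nlinarith)
  have h8 : n ^ 4 / 3 * (n ^ 2 * r / 8 - 16)
      ≤ n * (n - 1) / 2 * (2 * (n - 2)) ^ 2 * ((n - 3) * (1 - 2 * p ^ 2) + 4) ^ 2 :=
    (mul_le_mul_of_nonneg_left h5 (by positivity)).trans
      (mul_le_mul_of_nonneg_right h7 (sq_nonneg _))
  have h9 := mul_le_mul_of_nonneg_left h8 (show 0 ≤ p ^ 3 * (1 - p) by positivity)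
  have e1 : p * (1 - p) * (n * (n - 1) / 2 *
      (2 * (n - 2) * p * ((n - 3) * (1 - 2 * p ^ 2) + 4)) ^ 2) = p ^ 3 * (1 - p) *
      (n * (n - 1) / 2 * (2 * (n - 2)) ^ 2 * ((n - 3) * (1 - 2 * p ^ 2) + 4) ^ 2) := by ring
  rw [e1] at h0
  have e2 : p ^ 3 * (1 - p) * (n ^ 4 / 3 * (n ^ 2 * r / 8 - 16))
      = n ^ 6 * p ^ 3 * (1 - p) * r / 24 - 16 / 3 * (n ^ 4 * p ^ 3 * (1 - p)) := by ring
  rw [e2] at h9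
  linarith

lemma card_cycles_ge (hn : 288 ≤ (Fintype.card V : ℝ)) :
    (Fintype.card V : ℝ) ^ 4 / 2 ≤ (cycles V).card := by
  rw [card_cycles]
  set n : ℝ := (Fintype.card V : ℝ)
  have a1 : 3 / 4 * n ^ 2 ≤ n * (n - 1) := by nlinarith
  have a2 : 3 / 4 * n ^ 2 ≤ (n - 2) * (n - 3) := by nlinarith
  calc n ^ 4 / 2 ≤ 3 / 4 * n ^ 2 * (3 / 4 * n ^ 2) := by nlinarith [sq_nonneg (n ^ 2)]
    _ ≤ n * (n - 1) * ((n - 2) * (n - 3)) := mul_le_mul a1 a2 (by positivity) (by nlinarith)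
    _ = _ := by ring

/-- Double counting of pairs of arcs in 4-cycles. -/
lemma sum_card_cycles_mem_mem (P : Finset (Sym2 V × Sym2 V)) :
    ∑ x ∈ P, (Finset.card {t ∈ cycles V | x.1 ∈ cycleArcs t ∧ x.2 ∈ cycleArcs t} : ℝ)
      = ∑ t ∈ cycles V, (Finset.card {x ∈ P | x.1 ∈ cycleArcs t ∧ x.2 ∈ cycleArcs t} : ℝ) := by
  exact_mod_cast Finset.sum_card_bipartiteAbove_eq_sum_card_bipartiteBelow
    (s := P) (t := cycles V) (fun x t => x.1 ∈ cycleArcs t ∧ x.2 ∈ cycleArcs t)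

lemma sum_bernExp_diffAt_diffAt {P : Finset (Sym2 V × Sym2 V)} (hP : P ⊆ (arcs V).offDiag) :
    ∑ x ∈ P, bernExp p (arcs V) (diffAt x.1 (diffAt x.2 (pairsMinusCycles V)))
      = 4 * P.card - 1 / 2 * p ^ 2 * ∑ t ∈ cycles V,
        (Finset.card {x ∈ P | x.1 ∈ cycleArcs t ∧ x.2 ∈ cycleArcs t} : ℝ) := by
  rw [← sum_card_cycles_mem_mem, Finset.mul_sum]
  have h : ∀ x ∈ P, bernExp p (arcs V) (diffAt x.1 (diffAt x.2 (pairsMinusCycles V)))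
      = 4 - 1 / 2 * p ^ 2 *
        (Finset.card {t ∈ cycles V | x.1 ∈ cycleArcs t ∧ x.2 ∈ cycleArcs t} : ℝ) := by
    intro x hx
    have hx' := Finset.mem_offDiag.1 (hP hx)
    rw [bernExp_diffAt_diffAt_pairsMinusCycles hx'.1 hx'.2.1 hx'.2.2]
    ring
  rw [Finset.sum_congr rfl h, Finset.sum_sub_distrib, Finset.sum_const, nsmul_eq_mul, mul_comm]

/-- For small `p` the second-order coefficients are positive on average over all pairs of arcs. -/
lemma bernVar_pairsMinusCycles_ge_of_le (hp0 : 0 ≤ p) (hp1 : p ≤ 1 / 3)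
    (hn : 288 ≤ (Fintype.card V : ℝ)) :
    (Fintype.card V : ℝ) ^ 4 * p ^ 2 * (1 - p)
      ≤ 27 * bernVar p (arcs V) (pairsMinusCycles V) := by
  have hV := bernVar_nonneg (U := arcs V) hp0 (hp1.trans (by norm_num)) (pairsMinusCycles V)
  have h0 := sq_sum_bernExp_diffAt_diffAt_le (U := arcs V) hp0 (hp1.trans (by norm_num))
    (pairsMinusCycles V) subset_rfl
  -- A 4-cycle contains `4 * 3` ordered pairs of arcs.
  have h1 : ∀ t ∈ cycles V, (Finset.card {x ∈ (arcs V).offDiag |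
      x.1 ∈ cycleArcs t ∧ x.2 ∈ cycleArcs t} : ℝ) = 12 := by
    intro t ht
    have : ({x ∈ (arcs V).offDiag | x.1 ∈ cycleArcs t ∧ x.2 ∈ cycleArcs t} : Finset _)
        = (cycleArcs t).offDiag := by
      ext x
      simp only [Finset.mem_filter, Finset.mem_offDiag]
      exact ⟨fun h => ⟨h.2.1, h.2.2, h.1.2.2⟩,
        fun h => ⟨⟨cycleArcs_subset ht h.1, cycleArcs_subset ht h.2.1, h.2.2⟩, h.1, h.2.1⟩⟩
    rw [this, Finset.offDiag_card, card_cycleArcs ht]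
    norm_num
  have h2 : ((arcs V).offDiag.card : ℝ) = (arcs V).card * ((arcs V).card - 1) := by
    rw [Finset.offDiag_card, Nat.cast_sub (Nat.le_mul_self _)]
    push_cast
    ring
  rw [sum_bernExp_diffAt_diffAt subset_rfl, Finset.sum_congr rfl h1, Finset.sum_const,
    nsmul_eq_mul, h2, card_arcs, card_cycles] at h0
  set n : ℝ := (Fintype.card V : ℝ) with hn'
  have h3 : n ^ 4 / 6 ≤ 4 * (n * (n - 1) / 2 * (n * (n - 1) / 2 - 1))
      - 1 / 2 * p ^ 2 * (n * (n - 1) * (n - 2) * (n - 3) * 12) := by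
    have h4 := card_cycles_ge hn
    rw [card_cycles, ← hn'] at h4
    have h5 : p ^ 2 ≤ 1 / 9 := by nlinarith
    have h6 : p ^ 2 * (n * (n - 1) * (n - 2) * (n - 3))
        ≤ 1 / 9 * (n * (n - 1) * (n - 2) * (n - 3)) :=
      mul_le_mul_of_nonneg_right h5 (le_trans (by positivity) h4)
    have h7 : 4 * (n * (n - 1) / 2 * (n * (n - 1) / 2 - 1))
        = n * (n - 1) * (n - 2) * (n - 3) + 4 * (n * (n - 1) * (n - 2)) := by ring
    have h8 : 0 ≤ n * (n - 1) * (n - 2) :=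
      mul_nonneg (mul_nonneg (by linarith) (by linarith)) (by linarith)
    rw [h7]
    linarith
  have h9 : (n ^ 4 / 6) ^ 2 ≤ (4 * (n * (n - 1) / 2 * (n * (n - 1) / 2 - 1))
      - 1 / 2 * p ^ 2 * (n * (n - 1) * (n - 2) * (n - 3) * 12)) ^ 2 :=
    pow_le_pow_left₀ (by positivity) h3 2
  have h10 : n * (n - 1) / 2 * (n * (n - 1) / 2 - 1) ≤ n ^ 4 / 4 := by
    calc n * (n - 1) / 2 * (n * (n - 1) / 2 - 1) ≤ n ^ 2 / 2 * (n ^ 2 / 2) :=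
          mul_le_mul (by nlinarith) (by nlinarith) (by nlinarith) (by positivity)
      _ = n ^ 4 / 4 := by ring
  have h11 := (mul_le_mul_of_nonneg_left h9
    (show 0 ≤ (p * (1 - p)) ^ 2 / 2 by positivity)).trans
    (h0.trans (mul_le_mul_of_nonneg_right h10 hV))
  have hn4 : 0 < n ^ 4 := by positivity
  have h12 : n ^ 4 * ((p * (1 - p)) ^ 2 * n ^ 4 / 72)
      ≤ n ^ 4 * (bernVar p (arcs V) (pairsMinusCycles V) / 4) := by
    calc _ = (p * (1 - p)) ^ 2 / 2 * (n ^ 4 / 6) ^ 2 := by ring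
      _ ≤ _ := h11
      _ = _ := by ring
  have h13 := le_of_mul_le_mul_left h12 hn4
  have h14 : n ^ 4 * p ^ 2 * (1 - p) * (2 / 3) ≤ n ^ 4 * p ^ 2 * (1 - p) * (1 - p) :=
    mul_le_mul_of_nonneg_left (by linarith)
      (mul_nonneg (by positivity) (by linarith))
  nlinarith

/-- For `p` bounded away from `0` the second-order coefficients of pairs of arcs that share a node
are of order `n`, because such a pair lies in about `n` 4-cycles. -/
lemma bernVar_pairsMinusCycles_ge_of_ge (hp0 : 1 / 3 ≤ p) (hp1 : p ≤ 1)
    (hn : 288 ≤ (Fintype.card V : ℝ)) :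
    (Fintype.card V : ℝ) ^ 5 * p ^ 2 * (1 - p) ^ 2
      ≤ 10368 * bernVar p (arcs V) (pairsMinusCycles V) := by
  have hp0' : 0 ≤ p := le_trans (by norm_num) hp0
  have hV := bernVar_nonneg (U := arcs V) hp0' hp1 (pairsMinusCycles V)
  -- The test set: pairs of arcs with a common node.
  let P : Finset (Sym2 V × Sym2 V) := {x ∈ (arcs V).offDiag | ∃ v, v ∈ x.1 ∧ v ∈ x.2}
  have hP : P ⊆ (arcs V).offDiag := Finset.filter_subset _ _
  have h0 := sq_sum_bernExp_diffAt_diffAt_le (U := arcs V) hp0' hp1 (pairsMinusCycles V) hP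
  have hPc : (P.card : ℝ) ≤ (Fintype.card V : ℝ) ^ 3 := by
    have hsub : P ⊆ (Finset.univ : Finset (V × V × V)).image
        fun x => (s(x.1, x.2.1), s(x.1, x.2.2)) := by
      rintro ⟨a, b⟩ hx
      obtain ⟨v, hv1, hv2⟩ := (Finset.mem_filter.1 hx).2
      obtain ⟨i, rfl⟩ := Sym2.mem_iff_exists.1 hv1
      obtain ⟨k, rfl⟩ := Sym2.mem_iff_exists.1 hv2
      exact Finset.mem_image.2 ⟨(v, i, k), Finset.mem_univ _, rfl⟩
    have := (Finset.card_le_card hsub).trans Finset.card_image_le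
    rw [Finset.card_univ, Fintype.card_prod, Fintype.card_prod] at this
    calc (P.card : ℝ) ≤ ((Fintype.card V * (Fintype.card V * Fintype.card V) : ℕ) : ℝ) := by
          exact_mod_cast this
      _ = _ := by push_cast; ring
  have h1 : ∀ t ∈ cycles V,
      1 ≤ (Finset.card {x ∈ P | x.1 ∈ cycleArcs t ∧ x.2 ∈ cycleArcs t} : ℝ) := by
    rintro ⟨⟨i, j⟩, ⟨k, l⟩⟩ ht
    have hs := cycleArcs_subset ht
    have hm1 : s(i, j) ∈ cycleArcs ((i, j), (k, l)) := by simp [cycleArcs]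
    have hm2 : s(j, k) ∈ cycleArcs ((i, j), (k, l)) := by simp [cycleArcs]
    simp only [cycles, Finset.mem_filter, Finset.mem_univ, true_and] at ht
    have hne : s(i, j) ≠ s(j, k) := by rw [Ne, Sym2.eq_iff]; grind
    have hmem : (s(i, j), s(j, k)) ∈ ({x ∈ P | x.1 ∈ cycleArcs ((i, j), (k, l)) ∧
        x.2 ∈ cycleArcs ((i, j), (k, l))} : Finset _) := by
      refine Finset.mem_filter.2 ⟨Finset.mem_filter.2 ⟨?_, j, by simp, by simp⟩, hm1, hm2⟩
      exact Finset.mem_offDiag.2 ⟨hs hm1, hs hm2, hne⟩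
    exact_mod_cast Finset.card_pos.2 ⟨_, hmem⟩
  have h2 := Finset.sum_le_sum h1
  rw [Finset.sum_const, nsmul_eq_mul, mul_one] at h2
  have h3 := (card_cycles_ge hn).trans h2
  rw [sum_bernExp_diffAt_diffAt hP] at h0
  set n : ℝ := (Fintype.card V : ℝ) with hn'
  set X := ∑ t ∈ cycles V, (Finset.card {x ∈ P | x.1 ∈ cycleArcs t ∧ x.2 ∈ cycleArcs t} : ℝ)
  -- The contribution of the 4-cycles, of order `n ^ 4`, outweighs that of the pairs of arcs.
  have h4 : n ^ 4 / 72 ≤ -(4 * P.card - 1 / 2 * p ^ 2 * X) := by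
    have h5 : 1 / 9 ≤ p ^ 2 := by nlinarith
    have h6 : 1 / 9 * (n ^ 4 / 2) ≤ p ^ 2 * X := mul_le_mul h5 h3 (by positivity) (sq_nonneg p)
    have h7 : 288 * n ^ 3 ≤ n ^ 4 := by
      calc 288 * n ^ 3 ≤ n * n ^ 3 := mul_le_mul_of_nonneg_right hn (by positivity)
        _ = n ^ 4 := by ring
    linarith
  have h8 : (n ^ 4 / 72) ^ 2 ≤ (4 * P.card - 1 / 2 * p ^ 2 * X) ^ 2 := by
    rw [← neg_sq (4 * P.card - 1 / 2 * p ^ 2 * X)]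
    exact pow_le_pow_left₀ (by positivity) h4 2
  have h9 := (mul_le_mul_of_nonneg_left h8
    (show 0 ≤ (p * (1 - p)) ^ 2 / 2 by positivity)).trans
    (h0.trans (mul_le_mul_of_nonneg_right hPc hV))
  have h10 : n ^ 3 * (n ^ 5 * p ^ 2 * (1 - p) ^ 2)
      ≤ n ^ 3 * (10368 * bernVar p (arcs V) (pairsMinusCycles V)) := by
    calc _ = 10368 * ((p * (1 - p)) ^ 2 / 2 * (n ^ 4 / 72) ^ 2) := by ring
      _ ≤ 10368 * (n ^ 3 * bernVar p (arcs V) (pairsMinusCycles V)) := by linarith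
      _ = _ := by ring
  exact le_of_mul_le_mul_left h10 (by positivity)

end PolynomialPart

/-! ### The paths of length two that do not span an edge of the polytope -/

section ShortcutPaths

variable {V : Type*} [Fintype V] [DecidableEq V]

/-- The common neighbours of `i` and `l` in the graph with arc set `S`. -/
def commonNbrs (S : Finset (Sym2 V)) (i l : V) : Finset V := {j | s(i, j) ∈ S ∧ s(j, l) ∈ S}

/-- The number of paths `i j l` for which `i` can be joined to `l` in another way by at most two
arcs. -/
def shortcutCount (S : Finset (Sym2 V)) (i l : V) : ℕ :=
  if s(i, l) ∈ S ∨ 2 ≤ (commonNbrs S i l).card then (commonNbrs S i l).card else 0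

/-- The number of paths `i j l` with `i ≠ l` for which `i` can be joined to `l` in another way by at
most two arcs. -/
noncomputable def shortcutPaths (S : Finset (Sym2 V)) : ℝ :=
  ∑ i, ∑ l, if i ≠ l then (shortcutCount S i l : ℝ) else 0

/-- The degree of `u` in the graph with arc set `S`. -/
noncomputable def nodeDegree (u : V) (S : Finset (Sym2 V)) : ℝ :=
  familyCount (Finset.univ.erase u) (fun x => {s(u, x)}) S

lemma commonNbrs_mono {S S' : Finset (Sym2 V)} (h : S' ⊆ S) (i l : V) :
    commonNbrs S' i l ⊆ commonNbrs S i l := by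
  intro j
  simp only [commonNbrs, Finset.mem_filter, Finset.mem_univ, true_and]
  exact fun hj => ⟨h hj.1, h hj.2⟩

lemma shortcutCount_mono {S S' : Finset (Sym2 V)} (h : S' ⊆ S) (i l : V) :
    shortcutCount S' i l ≤ shortcutCount S i l := by
  have hc := Finset.card_le_card (commonNbrs_mono h i l)
  unfold shortcutCount
  by_cases h1 : s(i, l) ∈ S'
  · have h2 := h h1
    simp [h1, h2, hc]
  · split_ifs with h3 h4 h5
    · exact hc
    · have : ¬ 2 ≤ (commonNbrs S i l).card := fun h => h4 (Or.inr h)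
      have : 2 ≤ (commonNbrs S' i l).card := h3.resolve_left h1
      omega
    · exact Nat.zero_le _
    · exact le_rfl

/-- Removing `e` changes the count at `(i, l)` by at most twice the number of common neighbours
lost, unless `e` joins `i` and `l`. -/
lemma shortcutCount_le {S S' : Finset (Sym2 V)} {e : Sym2 V} (h : S' ⊆ S) (he : S ⊆ insert e S')
    (i l : V) :
    (shortcutCount S i l : ℝ) - shortcutCount S' i l
      ≤ 2 * (((commonNbrs S i l).card : ℝ) - (commonNbrs S' i l).card)
        + if s(i, l) = e then ((commonNbrs S' i l).card : ℝ) else 0 := by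
  have hc := Finset.card_le_card (commonNbrs_mono h i l)
  have key : shortcutCount S i l + 2 * (commonNbrs S' i l).card
      ≤ shortcutCount S' i l + 2 * (commonNbrs S i l).card
        + if s(i, l) = e then (commonNbrs S' i l).card else 0 := by
    unfold shortcutCount
    have h1 : s(i, l) ∈ S → s(i, l) = e ∨ s(i, l) ∈ S' := fun h => Finset.mem_insert.1 (he h)
    by_cases h2 : s(i, l) = e
    · rw [if_pos h2]
      split_ifs <;> omega
    · rw [if_neg h2]
      have h3 : s(i, l) ∈ S ↔ s(i, l) ∈ S' := ⟨fun h => (h1 h).resolve_left h2, fun h' => h h'⟩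
      simp only [h3]
      by_cases h4 : s(i, l) ∈ S'
      · simp only [h4, true_or, if_true]; omega
      · simp only [h4, false_or]
        split_ifs <;> omega
  have key' : (shortcutCount S i l : ℝ) + 2 * (commonNbrs S' i l).card
      ≤ shortcutCount S' i l + 2 * (commonNbrs S i l).card
        + if s(i, l) = e then ((commonNbrs S' i l).card : ℝ) else 0 := by
    exact_mod_cast key
  linarith

lemma nodeDegree_eq {S : Finset (Sym2 V)} (hS : S ⊆ arcs V) (u : V) :
    nodeDegree u S = ∑ x, if s(u, x) ∈ S then (1 : ℝ) else 0 := by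
  have h : s(u, u) ∉ S := fun h => by simpa [arcs] using hS h
  rw [nodeDegree, familyCount, ← Finset.add_sum_erase _ _ (Finset.mem_univ u), if_neg h, zero_add]
  simp

/-- An arc lies on a path of length two that starts at `i` only as its first or second arc. -/
lemma card_commonNbrs_sub_le {S S' : Finset (Sym2 V)} {e : Sym2 V}
    (he : S ⊆ insert e S') {i l : V} (hil : i ≠ l) :
    ((commonNbrs S i l).card : ℝ) - (commonNbrs S' i l).card
      ≤ ∑ j, ((if s(i, j) = e then if s(j, l) ∈ S' then (1 : ℝ) else 0 else 0)
        + if s(l, j) = e then if s(j, i) ∈ S' then 1 else 0 else 0) := by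
  rw [commonNbrs, commonNbrs, Finset.card_filter, Finset.card_filter, Nat.cast_sum, Nat.cast_sum,
    ← Finset.sum_sub_distrib]
  refine Finset.sum_le_sum fun j _ => ?_
  have hne : s(i, j) ≠ s(j, l) := by rw [Ne, Sym2.eq_iff]; grind
  have h1 : s(i, j) ∈ S → s(i, j) = e ∨ s(i, j) ∈ S' := fun h => Finset.mem_insert.1 (he h)
  have h2 : s(j, l) ∈ S → s(j, l) = e ∨ s(j, l) ∈ S' := fun h => Finset.mem_insert.1 (he h)
  rw [Sym2.eq_swap (a := l), Sym2.eq_swap (a := j) (b := i)]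
  by_cases h3 : s(i, j) = e
  · have h4 : s(j, l) ≠ e := fun h => hne (h3.trans h.symm)
    have h5 : s(j, l) ∈ S → s(j, l) ∈ S' := fun h => (h2 h).resolve_left h4
    simp only [h3, h4, if_true, if_false]
    split_ifs <;> simp_all
  · have h5 : s(i, j) ∈ S → s(i, j) ∈ S' := fun h => (h1 h).resolve_left h3
    simp only [h3, if_false]
    split_ifs <;> simp_all

lemma sum_ite_eq_arc {u v : V} (huv : u ≠ v) (g : V → V → ℝ) :
    ∑ i, ∑ j, (if s(i, j) = s(u, v) then g i j else 0) = g u v + g v u := by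
  rw [← Fintype.sum_prod_type' (f := fun i j => if s(i, j) = s(u, v) then g i j else 0),
    ← Finset.sum_filter]
  have : (Finset.univ.filter fun x : V × V => s(x.1, x.2) = s(u, v)) = {(u, v), (v, u)} := by
    ext ⟨a, b⟩
    simp
  rw [this, Finset.sum_pair (by simp [huv])]

lemma diffAt_shortcutPaths_nonneg (e : Sym2 V) (S : Finset (Sym2 V)) :
    0 ≤ diffAt e shortcutPaths S := by
  rw [diffAt, sub_nonneg]
  refine Finset.sum_le_sum fun i _ => Finset.sum_le_sum fun l _ => ?_
  split_ifs
  · exact_mod_cast shortcutCount_mono ((Finset.erase_subset _ _).trans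
      (Finset.subset_insert _ _)) i l
  · exact le_rfl

lemma diffAt_shortcutPaths_le {u v : V} (huv : u ≠ v) {S : Finset (Sym2 V)} (hS : S ⊆ arcs V) :
    diffAt s(u, v) shortcutPaths S ≤ 5 * (nodeDegree u S + nodeDegree v S) := by
  set e : Sym2 V := s(u, v) with he
  have hsub : S.erase e ⊆ insert e S := (Finset.erase_subset _ _).trans (Finset.subset_insert _ _)
  have hins : insert e S ⊆ insert e (S.erase e) := by
    intro a ha
    rw [Finset.mem_insert] at ha ⊢
    by_cases h : a = e
    · exact Or.inl h
    · exact Or.inr (Finset.mem_erase.2 ⟨h, ha.resolve_left h⟩)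
  set S' := S.erase e with hS'
  have hdeg : ∀ w : V, (∑ x, if s(w, x) ∈ S' then (1 : ℝ) else 0) ≤ nodeDegree w S := by
    intro w
    rw [nodeDegree_eq hS]
    refine Finset.sum_le_sum fun x _ => ?_
    by_cases h : s(w, x) ∈ S'
    · simp [h, Finset.mem_of_mem_erase h]
    · rw [if_neg h]; split_ifs <;> norm_num
  have hcom : ∀ w z : V, ((commonNbrs S' w z).card : ℝ) ≤ nodeDegree w S := by
    intro w z
    refine le_trans ?_ (hdeg w)
    rw [commonNbrs, Finset.card_filter, Nat.cast_sum]
    refine Finset.sum_le_sum fun x _ => ?_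
    by_cases h : s(w, x) ∈ S'
    · simp only [h, true_and, if_true]; split_ifs <;> norm_num
    · simp [h]
  -- `α i j l` indicates that `e` is the first arc of a path `i j l` whose second arc is present.
  let α : V → V → V → ℝ := fun i j l =>
    if s(i, j) = e then if s(j, l) ∈ S' then (1 : ℝ) else 0 else 0
  have hα0 : ∀ i j l, 0 ≤ α i j l := fun i j l => by
    simp only [α]; split_ifs <;> norm_num
  have hα : ∑ i, ∑ l, ∑ j, α i j l ≤ nodeDegree u S + nodeDegree v S := by
    have h1 : ∑ i, ∑ l, ∑ j, α i j l = ∑ i, ∑ j, if s(i, j) = s(u, v) then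
        (∑ l, if s(j, l) ∈ S' then (1 : ℝ) else 0) else 0 := by
      refine Finset.sum_congr rfl fun i _ => ?_
      rw [Finset.sum_comm]
      refine Finset.sum_congr rfl fun j _ => ?_
      simp only [α, he]
      split_ifs <;> simp
    rw [h1, sum_ite_eq_arc huv]
    linarith [hdeg u, hdeg v]
  have h1 : diffAt e shortcutPaths S ≤ ∑ i, ∑ l,
      (2 * ∑ j, (α i j l + α l j i)
        + if s(i, l) = s(u, v) then ((commonNbrs S' i l).card : ℝ) else 0) := by
    rw [diffAt, shortcutPaths, shortcutPaths, ← Finset.sum_sub_distrib]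
    refine Finset.sum_le_sum fun i _ => ?_
    rw [← Finset.sum_sub_distrib]
    refine Finset.sum_le_sum fun l _ => ?_
    by_cases hil : i = l
    · subst hil
      simp only [ne_eq, not_true, if_false, sub_zero]
      have : 0 ≤ ∑ j, (α i j i + α i j i) :=
        Finset.sum_nonneg fun j _ => add_nonneg (hα0 _ _ _) (hα0 _ _ _)
      split_ifs <;> positivity
    · rw [if_pos hil, if_pos hil]
      have h2 := shortcutCount_le hsub hins i l
      have h3 := card_commonNbrs_sub_le hins hil
      exact h2.trans (add_le_add (mul_le_mul_of_nonneg_left h3 (by norm_num)) le_rfl)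
  refine h1.trans ?_
  simp only [Finset.sum_add_distrib, ← Finset.mul_sum]
  rw [sum_ite_eq_arc huv, Finset.sum_comm (f := fun i l => ∑ j, α l j i)]
  linarith [hcom u v, hcom v u]

lemma bernExp_sq_nodeDegree_le {p : ℝ} (hp0 : 0 ≤ p) (hp1 : p ≤ 1) (u : V) :
    bernExp p (arcs V) (fun S => nodeDegree u S ^ 2)
      ≤ (Fintype.card V : ℝ) * p + (Fintype.card V : ℝ) ^ 2 * p ^ 2 := by
  have hA : ∀ x ∈ Finset.univ.erase u, ({s(u, x)} : Finset (Sym2 V)) ⊆ arcs V := by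
    intro x hx
    rw [Finset.singleton_subset_iff]
    simpa [arcs] using (Finset.ne_of_mem_erase hx).symm
  have hk : ∀ x ∈ Finset.univ.erase u, ({s(u, x)} : Finset (Sym2 V)).card = 1 :=
    fun x _ => Finset.card_singleton _
  have hc : ((Finset.univ.erase u).card : ℝ) ≤ Fintype.card V := by
    exact_mod_cast Finset.card_le_univ _
  rw [sq_bernExp_add_bernVar, add_comm]
  refine add_le_add ?_ ?_
  · refine (bernVar_familyCount_le hp0 hp1 hA hk).trans ?_
    have h1 : ∀ t ∈ Finset.univ.erase u, (Finset.card {x ∈ Finset.univ.erase u |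
        ¬ Disjoint ({s(u, t)} : Finset (Sym2 V)) {s(u, x)}} : ℝ) * p ^ 1 ≤ p := by
      intro t _
      have : ({x ∈ Finset.univ.erase u |
          ¬ Disjoint ({s(u, t)} : Finset (Sym2 V)) {s(u, x)}} : Finset V) ⊆ {t} := by
        intro x hx
        rw [Finset.mem_filter, Finset.disjoint_singleton, not_not, Sym2.congr_right] at hx
        exact Finset.mem_singleton.2 hx.2.symm
      have h2 : (Finset.card {x ∈ Finset.univ.erase u |
          ¬ Disjoint ({s(u, t)} : Finset (Sym2 V)) {s(u, x)}} : ℝ) ≤ 1 := by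
        exact_mod_cast Finset.card_le_card this
      rw [pow_one]
      exact mul_le_of_le_one_left hp0 h2
    refine (Finset.sum_le_sum h1).trans ?_
    rw [Finset.sum_const, nsmul_eq_mul]
    exact mul_le_mul_of_nonneg_right hc hp0
  · unfold nodeDegree
    rw [bernExp_familyCount hA hk, pow_one, ← mul_pow]
    exact pow_le_pow_left₀ (by positivity) (mul_le_mul_of_nonneg_right hc hp0) 2

lemma bernVar_shortcutPaths_le {p : ℝ} (hp0 : 0 ≤ p) (hp1 : p ≤ 1) :
    bernVar p (arcs V) shortcutPaths ≤ 50 * ((Fintype.card V : ℝ) ^ 3 * p ^ 2 * (1 - p)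
      + (Fintype.card V : ℝ) ^ 4 * p ^ 3 * (1 - p)) := by
  have hpq : 0 ≤ p * (1 - p) := mul_nonneg hp0 (sub_nonneg.2 hp1)
  refine (bernVar_le_sum_diffAt hp0 hp1 _).trans ?_
  set n : ℝ := (Fintype.card V : ℝ) with hn
  have h1 : ∀ e ∈ arcs V, bernExp p (arcs V) (fun S => diffAt e shortcutPaths S ^ 2)
      ≤ 100 * (n * p + n ^ 2 * p ^ 2) := by
    intro e he
    induction e with
    | _ u v =>
    have huv : u ≠ v := by simpa [arcs] using he
    calc bernExp p (arcs V) (fun S => diffAt s(u, v) shortcutPaths S ^ 2)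
        ≤ bernExp p (arcs V) (fun S => 50 * (nodeDegree u S ^ 2 + nodeDegree v S ^ 2)) := by
          refine bernExp_mono hp0 hp1 fun S hS => ?_
          have h2 := diffAt_shortcutPaths_le huv hS
          have h3 := pow_le_pow_left₀ (diffAt_shortcutPaths_nonneg s(u, v) S) h2 2
          nlinarith [sq_nonneg (nodeDegree u S - nodeDegree v S)]
      _ = 50 * (bernExp p (arcs V) (fun S => nodeDegree u S ^ 2)
            + bernExp p (arcs V) (fun S => nodeDegree v S ^ 2)) := by
          rw [bernExp_const_mul, bernExp_add]
      _ ≤ _ := by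
          have h4 := bernExp_sq_nodeDegree_le hp0 hp1 u
          have h5 := bernExp_sq_nodeDegree_le hp0 hp1 v
          linarith
  refine (mul_le_mul_of_nonneg_left (Finset.sum_le_sum h1) hpq).trans ?_
  rw [sum_arcs_const, ← hn]
  have hn0 : 0 ≤ n := by positivity
  have h2 : n * (n - 1) / 2 * (100 * (n * p + n ^ 2 * p ^ 2))
      ≤ n ^ 2 / 2 * (100 * (n * p + n ^ 2 * p ^ 2)) :=
    mul_le_mul_of_nonneg_right (by nlinarith) (by positivity)
  refine (mul_le_mul_of_nonneg_left h2 hpq).trans (le_of_eq ?_)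
  ring

end ShortcutPaths

/-! ### The edges of a symmetric edge polytope -/

section Geometry

/-- A face of the convex hull of `A` is the convex hull of the points of `A` on the supporting
hyperplane. -/
lemma convexHull_inter_hyperplane {E : Type*} [AddCommGroup E] [Module ℝ E] {A : Set E}
    {l : E →ₗ[ℝ] ℝ} {c : ℝ} (h : ∀ x ∈ A, l x ≤ c) :
    convexHull ℝ A ∩ {x | l x = c} = convexHull ℝ (A ∩ {x | l x = c}) := by
  apply Set.Subset.antisymm
  · have hsub : convexHull ℝ A
        ⊆ {x | l x ≤ c ∧ (l x = c → x ∈ convexHull ℝ (A ∩ {x | l x = c}))} := by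
      refine convexHull_min (fun x hx => ⟨h x hx, fun hc => subset_convexHull ℝ _ ⟨hx, hc⟩⟩) ?_
      rw [convex_iff_forall_pos]
      rintro x ⟨hx1, hx2⟩ y ⟨hy1, hy2⟩ a b ha hb hab
      have hl : l (a • x + b • y) = a * l x + b * l y := by simp
      have h1 : a * l x ≤ a * c := mul_le_mul_of_nonneg_left hx1 ha.le
      have h2 : b * l y ≤ b * c := mul_le_mul_of_nonneg_left hy1 hb.le
      have h3 : a * c + b * c = c := by rw [← add_mul, hab, one_mul]
      refine ⟨by rw [hl]; linarith, fun heq => ?_⟩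
      rw [hl] at heq
      have h4 : l x = c := mul_left_cancel₀ ha.ne' (by linarith)
      have h5 : l y = c := mul_left_cancel₀ hb.ne' (by linarith)
      exact convex_convexHull ℝ _ (hx2 h4) (hy2 h5) ha.le hb.le hab
    rintro x ⟨hx, hxc⟩
    exact (hsub hx).2 hxc
  · refine Set.subset_inter (convexHull_mono Set.inter_subset_left) ?_
    exact convexHull_min Set.inter_subset_right (convex_hyperplane l.isLinear c)

/-- The points of a sphere on a common line are at most two. -/
lemma eq_or_eq_of_dotProduct_self_eq {V : Type*} [Fintype V] {x y z : V → ℝ} {s t : ℝ}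
    (hx : x ⬝ᵥ x = s) (hy : y ⬝ᵥ y = s) (hz : z ⬝ᵥ z = s) (hxy : x ≠ y)
    (h : z = t • (y - x) + x) : z = x ∨ z = y := by
  have hne : (y - x) ⬝ᵥ (y - x) ≠ 0 := by
    rw [Ne, dotProduct_self_eq_zero, sub_eq_zero]
    exact hxy.symm
  have h1 : t * (t - 1) * ((y - x) ⬝ᵥ (y - x)) = 0 := by
    rw [h] at hz
    simp only [add_dotProduct, dotProduct_add, smul_dotProduct, dotProduct_smul, sub_dotProduct,
      dotProduct_sub, smul_eq_mul] at hz ⊢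
    rw [dotProduct_comm y x] at *
    rw [hx, hy] at *
    linarith
  rcases mul_eq_zero.1 h1 with h2 | h2
  · rcases mul_eq_zero.1 h2 with h3 | h3
    · left; rw [h, h3, zero_smul, zero_add]
    · right; rw [h, sub_eq_zero.1 h3, one_smul, sub_add_cancel]
  · exact absurd h2 hne

variable {V : Type*} [DecidableEq V]

/-- The vertex `e_i - e_j` of the symmetric edge polytope that belongs to the directed arc
`(i, j)`. -/
def arcVec (d : V × V) : V → ℝ := Pi.single d.1 1 - Pi.single d.2 1

/-- The linear functional with coefficients `h`. -/
noncomputable def potential [Fintype V] (h : V → ℝ) : (V → ℝ) →ₗ[ℝ] ℝ :=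
  ∑ i, h i • LinearMap.proj i

lemma potential_arcVec [Fintype V] (h : V → ℝ) (d : V × V) :
    potential h (arcVec d) = h d.1 - h d.2 := by
  simp [potential, arcVec, mul_sub, Finset.sum_sub_distrib, Pi.single_apply]

lemma linearMap_arcVec (l : (V → ℝ) →ₗ[ℝ] ℝ) (d : V × V) :
    l (arcVec d) = l (Pi.single d.1 1) - l (Pi.single d.2 1) := by
  rw [arcVec, map_sub]

lemma arcVec_injOn {d d' : V × V} (hd : d.1 ≠ d.2) (h : arcVec d = arcVec d') : d = d' := by
  have h1 := congr_fun h d.1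
  have h2 := congr_fun h d.2
  simp only [arcVec, Pi.sub_apply, Pi.single_apply, if_true, hd, hd.symm, if_false] at h1 h2
  refine Prod.ext ?_ ?_
  · by_contra hne
    rw [if_neg hne] at h1
    split_ifs at h1 <;> norm_num at h1
  · by_contra hne
    rw [if_neg hne] at h2
    split_ifs at h2 <;> norm_num at h2

lemma arcVec_dotProduct_self [Fintype V] {d : V × V} (hd : d.1 ≠ d.2) :
    arcVec d ⬝ᵥ arcVec d = 2 := by
  simp only [arcVec, sub_dotProduct, dotProduct_sub, single_one_dotProduct, Pi.single_apply,
    if_true, hd, hd.symm, if_false]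
  norm_num

/-- The set of vertices of the symmetric edge polytope. -/
def arcVecs (G : SimpleGraph V) : Set (V → ℝ) := {x | ∃ d : V × V, G.Adj d.1 d.2 ∧ x = arcVec d}

lemma symmetricEdgePolytope_eq (G : SimpleGraph V) :
    symmetricEdgePolytope G = convexHull ℝ (arcVecs G) := by
  rw [symmetricEdgePolytope]
  congr 1
  ext x
  exact ⟨fun ⟨i, j, h, hx⟩ => ⟨(i, j), h, hx⟩, fun ⟨d, h, hx⟩ => ⟨d.1, d.2, h, hx⟩⟩

/-- Some node potential has its maximal drop along an arc of `G` exactly at `d` and `d'`. -/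
def IsTightPair (G : SimpleGraph V) (d d' : V × V) : Prop :=
  ∃ (h : V → ℝ) (c : ℝ), h d.1 - h d.2 = c ∧ h d'.1 - h d'.2 = c ∧
    ∀ e : V × V, G.Adj e.1 e.2 → e ≠ d → e ≠ d' → h e.1 - h e.2 < c

/-- The graph on the vertices of the symmetric edge polytope (as directed arcs) that is formed by
the edges of the polytope. -/
def edgeGraph (G : SimpleGraph V) : SimpleGraph (V × V) where
  Adj d d' := G.Adj d.1 d.2 ∧ G.Adj d'.1 d'.2 ∧ d ≠ d' ∧ d' ≠ d.swap ∧ IsTightPair G d d'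
  symm.symm := by
    rintro d d' ⟨h1, h2, h3, h4, h, c, h5, h6, h7⟩
    exact ⟨h2, h1, h3.symm, fun h8 => h4 (by rw [h8, Prod.swap_swap]), h, c, h6, h5,
      fun e he h8 h9 => h7 e he h9 h8⟩
  loopless.irrefl := fun d h => h.2.2.1 rfl

/-- The segment between the two vertices that belong to a pair of directed arcs. -/
def arcSegment : Sym2 (V × V) → Set (V → ℝ) :=
  Sym2.lift ⟨fun d d' => segment ℝ (arcVec d) (arcVec d'), fun _ _ => segment_symm ℝ _ _⟩

variable [Fintype V] {G : SimpleGraph V}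

lemma arcVecs_inter_hyperplane {d d' : V × V} (hd : G.Adj d.1 d.2) (hd' : G.Adj d'.1 d'.2)
    {h : V → ℝ} {c : ℝ} (h1 : h d.1 - h d.2 = c) (h2 : h d'.1 - h d'.2 = c)
    (h3 : ∀ e : V × V, G.Adj e.1 e.2 → e ≠ d → e ≠ d' → h e.1 - h e.2 < c) :
    (∀ x ∈ arcVecs G, potential h x ≤ c) ∧
      symmetricEdgePolytope G ∩ {x | potential h x = c} = segment ℝ (arcVec d) (arcVec d') := by
  have hle : ∀ x ∈ arcVecs G, potential h x ≤ c := by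
    rintro x ⟨e, he, rfl⟩
    rw [potential_arcVec]
    by_cases e1 : e = d
    · rw [e1, h1]
    by_cases e2 : e = d'
    · rw [e2, h2]
    exact (h3 e he e1 e2).le
  refine ⟨hle, ?_⟩
  rw [symmetricEdgePolytope_eq, convexHull_inter_hyperplane hle, ← convexHull_pair]
  congr 1
  ext x
  constructor
  · rintro ⟨⟨e, he, rfl⟩, hx⟩
    rw [Set.mem_ofPred_eq, potential_arcVec] at hx
    by_contra hne
    simp only [Set.mem_insert_iff, Set.mem_singleton_iff, not_or] at hne
    exact (h3 e he (fun h => hne.1 (h ▸ rfl)) (fun h => hne.2 (h ▸ rfl))).ne hx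
  · rintro (rfl | rfl)
    · exact ⟨⟨d, hd, rfl⟩, by rw [Set.mem_ofPred_eq, potential_arcVec, h1]⟩
    · exact ⟨⟨d', hd', rfl⟩, by rw [Set.mem_ofPred_eq, potential_arcVec, h2]⟩

lemma arcSegment_mem_polytopeEdges {d d' : V × V} (hadj : (edgeGraph G).Adj d d') :
    segment ℝ (arcVec d) (arcVec d') ∈ polytopeEdges (symmetricEdgePolytope G) := by
  obtain ⟨hd, hd', hne, hsw, h, c, h1, h2, h3⟩ := hadj
  obtain ⟨hle, hF⟩ := arcVecs_inter_hyperplane hd hd' h1 h2 h3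
  have hdsw : d.swap ≠ d := fun he => hd.ne (congr_arg Prod.snd he)
  have hc : -c < c := by
    have := h3 d.swap hd.symm hdsw hsw.symm
    rw [Prod.fst_swap, Prod.snd_swap] at this
    linarith
  refine ⟨⟨potential h, c, ?_, ?_, ?_, hF.symm⟩, ?_⟩
  · intro h0
    have := potential_arcVec h d
    rw [h0, h1, LinearMap.zero_apply] at this
    linarith
  · rw [symmetricEdgePolytope_eq]
    exact convexHull_min hle (convex_halfSpace_le (potential h).isLinear c)
  · intro hsub
    have hmem : arcVec d.swap ∈ symmetricEdgePolytope G := by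
      rw [symmetricEdgePolytope_eq]
      exact subset_convexHull ℝ _ ⟨d.swap, hd.symm, rfl⟩
    have := hsub hmem
    rw [Set.mem_ofPred_eq, potential_arcVec, Prod.fst_swap, Prod.snd_swap] at this
    linarith
  · rw [← convexHull_pair, affineSpan_convexHull, direction_affineSpan, vectorSpan_pair]
    refine finrank_span_singleton ?_
    rw [vsub_eq_sub, sub_ne_zero]
    exact fun he => hne (arcVec_injOn hd.ne he)

lemma exists_of_mem_polytopeEdges {F : Set (V → ℝ)}
    (hF : F ∈ polytopeEdges (symmetricEdgePolytope G)) :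
    ∃ d d', (edgeGraph G).Adj d d' ∧ F = segment ℝ (arcVec d) (arcVec d') := by
  obtain ⟨⟨l, c, -, hle, hnot, rfl⟩, hdim⟩ := hF
  rw [symmetricEdgePolytope_eq] at *
  have hleA : ∀ x ∈ arcVecs G, l x ≤ c := fun x hx => hle (subset_convexHull ℝ _ hx)
  rw [convexHull_inter_hyperplane hleA, affineSpan_convexHull, direction_affineSpan] at hdim
  set B := arcVecs G ∩ {x | l x = c} with hB
  have hnt : B.Nontrivial := by
    by_contra hs
    rw [Set.not_nontrivial_iff] at hs
    rw [vectorSpan_of_subsingleton ℝ hs, finrank_bot] at hdim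
    exact zero_ne_one hdim
  obtain ⟨x, ⟨⟨d, hd, rfl⟩, hx⟩, y, ⟨⟨d', hd', rfl⟩, hy⟩, hxy⟩ := hnt
  -- All vertices lie on a sphere, so the face has no vertex besides these two.
  have hcol : Collinear ℝ B := collinear_iff_finrank_le_one.2 hdim.le
  have honly : ∀ e : V × V, G.Adj e.1 e.2 → l (arcVec e) = c → e = d ∨ e = d' := by
    intro e he hec
    have hcol' : Collinear ℝ {arcVec d, arcVec d', arcVec e} := by
      refine hcol.subset ?_
      rintro z (rfl | rfl | rfl)
      exacts [⟨⟨d, hd, rfl⟩, hx⟩, ⟨⟨d', hd', rfl⟩, hy⟩, ⟨⟨e, he, rfl⟩, hec⟩]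
    obtain ⟨v, hv⟩ := (collinear_iff_of_mem (p₀ := arcVec d) (by simp)).1 hcol'
    obtain ⟨a, ha⟩ := hv (arcVec d') (by simp)
    obtain ⟨b, hb⟩ := hv (arcVec e) (by simp)
    rw [vadd_eq_add] at ha hb
    have ha0 : a ≠ 0 := by
      rintro rfl
      rw [zero_smul, zero_add] at ha
      exact hxy ha.symm
    have hb' : arcVec e = (b / a) • (arcVec d' - arcVec d) + arcVec d := by
      rw [ha, add_sub_cancel_right, smul_smul, div_mul_cancel₀ _ ha0, ← hb]
    rcases eq_or_eq_of_dotProduct_self_eq (arcVec_dotProduct_self hd.ne)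
      (arcVec_dotProduct_self hd'.ne) (arcVec_dotProduct_self he.ne) hxy hb' with h | h
    · exact Or.inl (arcVec_injOn he.ne h)
    · exact Or.inr (arcVec_injOn he.ne h)
  let h : V → ℝ := fun i => l (Pi.single i 1)
  have hl : ∀ e : V × V, h e.1 - h e.2 = l (arcVec e) := fun e => (linearMap_arcVec l e).symm
  have h1 : h d.1 - h d.2 = c := (hl d).trans hx
  have h2 : h d'.1 - h d'.2 = c := (hl d').trans hy
  have h3 : ∀ e : V × V, G.Adj e.1 e.2 → e ≠ d → e ≠ d' → h e.1 - h e.2 < c := by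
    intro e he hed hed'
    rw [hl]
    refine lt_of_le_of_ne (hleA _ ⟨e, he, rfl⟩) fun hec => ?_
    exact (honly e he hec).elim hed hed'
  have hlp : l = potential h := by
    refine LinearMap.pi_ext' fun i => LinearMap.ext_ring ?_
    simp [potential, h, Pi.single_apply]
  refine ⟨d, d', ⟨hd, hd', fun he => hxy (he ▸ rfl), ?_, h, c, h1, h2, h3⟩, ?_⟩
  · -- Otherwise `c = 0`, and by central symmetry the whole polytope lies on the hyperplane.
    intro hsw
    have hc : c = 0 := by
      rw [hsw, Prod.fst_swap, Prod.snd_swap] at h2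
      linarith
    refine hnot (convexHull_min ?_ (convex_halfSpace_ge l.isLinear c))
    rintro z ⟨e, he, rfl⟩
    have := hleA _ ⟨e.swap, he.symm, rfl⟩
    rw [← hl, Prod.fst_swap, Prod.snd_swap] at this
    rw [Set.mem_ofPred_eq, ← hl]
    linarith
  · rw [← (arcVecs_inter_hyperplane hd hd' h1 h2 h3).2, symmetricEdgePolytope_eq, hlp]

lemma mem_iff_arcVec_mem_arcSegment {z : Sym2 (V × V)} (hz : z ∈ (edgeGraph G).edgeSet)
    (e : V × V) : e ∈ z ↔ G.Adj e.1 e.2 ∧ arcVec e ∈ arcSegment z := by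
  induction z with
  | _ d d' =>
  obtain ⟨hd, hd', -, -, h, c, h1, h2, h3⟩ := hz
  rw [Sym2.mem_iff]
  simp only [arcSegment, Sym2.lift_mk]
  constructor
  · rintro (rfl | rfl)
    · exact ⟨hd, left_mem_segment ℝ _ _⟩
    · exact ⟨hd', right_mem_segment ℝ _ _⟩
  · rintro ⟨he, hmem⟩
    rw [← (arcVecs_inter_hyperplane hd hd' h1 h2 h3).2] at hmem
    have hec := hmem.2
    rw [Set.mem_ofPred_eq, potential_arcVec] at hec
    by_contra hne
    rw [not_or] at hne
    exact (h3 e he hne.1 hne.2).ne hec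

/-- Every edge of the polytope is the segment of exactly one unordered pair of directed arcs. -/
lemma sepEdgeCount_eq (G : SimpleGraph V) :
    sepEdgeCount G = (edgeGraph G).edgeSet.ncard := by
  have himg : polytopeEdges (symmetricEdgePolytope G) = arcSegment '' (edgeGraph G).edgeSet := by
    ext F
    constructor
    · intro hF
      obtain ⟨d, d', hadj, rfl⟩ := exists_of_mem_polytopeEdges hF
      exact ⟨s(d, d'), hadj, rfl⟩
    · rintro ⟨z, hz, rfl⟩
      induction z with
      | _ d d' => exact arcSegment_mem_polytopeEdges hz
  rw [sepEdgeCount, himg]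
  refine Set.InjOn.ncard_image fun z hz w hw hzw => Sym2.ext fun e => ?_
  rw [mem_iff_arcVec_mem_arcSegment hz, mem_iff_arcVec_mem_arcSegment hw, hzw]

end Geometry

/-! ### Pairs of directed arcs that span an edge -/

section TightPairs

variable {V : Type*} {G : SimpleGraph V}

lemma isTightPair_comm {d d' : V × V} : IsTightPair G d d' ↔ IsTightPair G d' d := by
  constructor <;>
  · rintro ⟨h, c, h1, h2, h3⟩
    exact ⟨h, c, h2, h1, fun e he h4 h5 => h3 e he h5 h4⟩

/-- The path `d d'` can be replaced by a shorter path or by another path of the same length. -/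
def HasShortcut (G : SimpleGraph V) (d d' : V × V) : Prop :=
  d.2 = d'.1 ∧ d.1 ≠ d'.2 ∧ (G.Adj d.1 d'.2 ∨ ∃ m, m ≠ d.2 ∧ G.Adj d.1 m ∧ G.Adj m d'.2)

/-- The heads of the arcs `d` and `d'` can be exchanged. -/
def HasExchange (G : SimpleGraph V) (d d' : V × V) : Prop :=
  d.1 ≠ d'.1 ∧ d.2 ≠ d'.2 ∧ G.Adj d.1 d'.2 ∧ G.Adj d'.1 d.2

lemma IsTightPair.not_hasExchange {d d' : V × V} (h : IsTightPair G d d') :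
    ¬ HasExchange G d d' := by
  obtain ⟨i, j⟩ := d
  obtain ⟨k, l⟩ := d'
  rintro ⟨hik, hjl, hs1, hs2⟩
  obtain ⟨h, c, h1, h2, h3⟩ := h
  dsimp only at *
  have h4 := h3 (i, l) hs1 (by simp [hjl.symm]) (by simp [hik])
  have h5 := h3 (k, j) hs2 (by simp [hik.symm]) (by simp [hjl])
  dsimp only at h4 h5
  linarith

variable [DecidableEq V]

lemma isTightPair_of_fst_eq {i j l : V} (hij : G.Adj i j) (hil : G.Adj i l) :
    IsTightPair G (i, j) (i, l) := by
  have h1 := hij.ne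
  have h2 := hil.ne
  refine ⟨fun x => if x = i then 1 else if x = j ∨ x = l then -1 else 0, 2, ?_, ?_, ?_⟩
  · simp [h1.symm]; norm_num
  · simp [h2.symm]; norm_num
  · rintro ⟨a, b⟩ he hd hd'
    simp only [ne_eq, Prod.mk.injEq, not_and] at he hd hd' ⊢
    split_ifs <;> (norm_num; try grind)

lemma isTightPair_of_snd_eq {i j k : V} (hij : G.Adj i j) (hkj : G.Adj k j) :
    IsTightPair G (i, j) (k, j) := by
  have h1 := hij.ne
  have h2 := hkj.ne
  refine ⟨fun x => if x = j then -1 else if x = i ∨ x = k then 1 else 0, 2, ?_, ?_, ?_⟩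
  · simp [h1]; norm_num
  · simp [h2]; norm_num
  · rintro ⟨a, b⟩ he hd hd'
    simp only [ne_eq, Prod.mk.injEq, not_and] at he hd hd' ⊢
    split_ifs <;> (norm_num; try grind)

open Classical in
/-- A path `i j l` gives an edge if there is no other way from `i` to `l` by at most two arcs. -/
lemma isTightPair_of_path {i j l : V} (hij : G.Adj i j) (hjl : G.Adj j l) (hne : i ≠ l)
    (hil : ¬ G.Adj i l) (hm : ∀ m, m ≠ j → G.Adj i m → ¬ G.Adj m l) :
    IsTightPair G (i, j) (j, l) := by
  have h1 := hij.ne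
  have h2 := hjl.ne
  refine ⟨fun x => if x = i then 1 else if x = l then -1 else if x = j then 0 else
    if G.Adj i x then 1 / 3 else if G.Adj x l then -1 / 3 else 0, 1, ?_, ?_, ?_⟩
  · simp [h1.symm, h2]
  · simp [h1.symm, h2, hne.symm]
  · rintro ⟨a, b⟩ he hd hd'
    simp only [ne_eq, Prod.mk.injEq, not_and] at he hd hd' ⊢
    have h3 := he.ne
    split_ifs <;> (norm_num; try grind)

/-- Two arcs `i j` and `k l` without common nodes give an edge if `i` and `l` are not adjacent. -/
lemma isTightPair_of_disjoint {i j k l : V} (hij : G.Adj i j) (hkl : G.Adj k l) (hik : i ≠ k)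
    (hjl : j ≠ l) (hjk : j ≠ k) (hne : i ≠ l) (hil : ¬ G.Adj i l) :
    IsTightPair G (i, j) (k, l) := by
  have h1 := hij.ne
  have h2 := hkl.ne
  refine ⟨fun x => if x = i then 1 else if x = j then -1 else if x = k then 1 / 2 else
    if x = l then -3 / 2 else 0, 2, ?_, ?_, ?_⟩
  · simp [h1.symm]; norm_num
  · simp [hik.symm, hjk.symm, hne.symm, hjl.symm, h2.symm]; norm_num
  · rintro ⟨a, b⟩ he hd hd'
    simp only [ne_eq, Prod.mk.injEq, not_and] at he hd hd' ⊢
    have h3 := he.ne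
    split_ifs <;> (norm_num; try grind)

lemma IsTightPair.not_hasShortcut {d d' : V × V} (h : IsTightPair G d d') :
    ¬ HasShortcut G d d' := by
  obtain ⟨i, j⟩ := d
  obtain ⟨k, l⟩ := d'
  rintro ⟨rfl : j = k, hne, hs⟩
  obtain ⟨h, c, h1, h2, h3⟩ := h
  dsimp only at *
  rcases hs with hs | ⟨m, hm, hs1, hs2⟩
  · by_cases hij : i = j
    · subst hij
      have := h3 (l, i) hs.symm (by simp [hne.symm]) (by simp [hne])
      dsimp only at this
      linarith
    by_cases hjl : j = l
    · subst hjl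
      have := h3 (j, i) hs.symm (by simp [hij, eq_comm]) (by simp [hij])
      dsimp only at this
      linarith
    have h4 := h3 (i, l) hs (by simp [eq_comm, hjl]) (by simp [hij])
    have h5 := h3 (l, i) hs.symm (by simp [hne.symm]) (by simp [hne])
    dsimp only at h4 h5
    linarith
  · have h4 := h3 (i, m) hs1 (by simp [hm]) (by rintro ⟨⟩; exact hs2.ne rfl)
    have h5 := h3 (m, l) hs2 (by rintro ⟨⟩; exact hs1.ne rfl) (by simp [hm])
    dsimp only at h4 h5
    linarith

/-- The combinatorial description of the edges of the symmetric edge polytope. -/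
lemma isTightPair_iff {d d' : V × V} (hd : G.Adj d.1 d.2) (hd' : G.Adj d'.1 d'.2)
    (hsw : d' ≠ d.swap) :
    IsTightPair G d d' ↔ ¬ HasShortcut G d d' ∧ ¬ HasShortcut G d' d ∧ ¬ HasExchange G d d' := by
  refine ⟨fun h => ⟨h.not_hasShortcut, (isTightPair_comm.1 h).not_hasShortcut,
    h.not_hasExchange⟩, ?_⟩
  obtain ⟨i, j⟩ := d
  obtain ⟨k, l⟩ := d'
  rintro ⟨h1, h2, h3⟩
  simp only [HasShortcut, HasExchange] at *
  rw [Prod.swap_prod_mk, Ne, Prod.mk.injEq, not_and] at hsw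
  by_cases hik : i = k
  · subst hik; exact isTightPair_of_fst_eq hd hd'
  by_cases hjl : j = l
  · subst hjl; exact isTightPair_of_snd_eq hd hd'
  by_cases hjk : j = k
  · subst hjk
    have hil : i ≠ l := fun h => hsw rfl h.symm
    refine isTightPair_of_path hd hd' hil (fun h => h1 ⟨rfl, hil, Or.inl h⟩) fun m hm h4 h5 => ?_
    exact h1 ⟨rfl, hil, Or.inr ⟨m, hm, h4, h5⟩⟩
  by_cases hil : i = l
  · subst hil
    have hkj : k ≠ j := fun h => hjk h.symm
    rw [isTightPair_comm]
    refine isTightPair_of_path hd' hd hkj (fun h => h2 ⟨rfl, hkj, Or.inl h⟩) fun m hm h4 h5 => ?_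
    exact h2 ⟨rfl, hkj, Or.inr ⟨m, hm, h4, h5⟩⟩
  by_cases h4 : G.Adj i l
  · have h5 : ¬ G.Adj k j := fun h => h3 ⟨hik, hjl, h4, h⟩
    rw [isTightPair_comm]
    exact isTightPair_of_disjoint hd' hd (Ne.symm hik) (Ne.symm hjl) (Ne.symm hil)
      (Ne.symm hjk) h5
  · exact isTightPair_of_disjoint hd hd' hik hjl hjk hil h4

open Classical in
/-- The pairs of arcs that form an edge are obtained from all pairs by removing four kinds of pairs
that exclude each other. -/
lemma edgeGraph_adj_indicator (d d' : V × V) :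
    (if (edgeGraph G).Adj d d' then (1 : ℝ) else 0)
      = (if G.Adj d.1 d.2 then 1 else 0) * (if G.Adj d'.1 d'.2 then 1 else 0)
        - (if d' = d then if G.Adj d.1 d.2 then 1 else 0 else 0)
        - (if d' = d.swap then if G.Adj d.1 d.2 then 1 else 0 else 0)
        - (if G.Adj d.1 d.2 ∧ G.Adj d'.1 d'.2 ∧ HasShortcut G d d' then 1 else 0)
        - (if G.Adj d'.1 d'.2 ∧ G.Adj d.1 d.2 ∧ HasShortcut G d' d then 1 else 0)
        - (if G.Adj d.1 d.2 ∧ G.Adj d'.1 d'.2 ∧ HasExchange G d d' then 1 else 0) := by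
  by_cases hd : G.Adj d.1 d.2
  swap
  · have h1 : ¬ (edgeGraph G).Adj d d' := fun h => hd h.1
    simp [hd, h1]
  by_cases hd' : G.Adj d'.1 d'.2
  swap
  · have h1 : ¬ (edgeGraph G).Adj d d' := fun h => hd' h.2.1
    have h2 : d' ≠ d := by rintro rfl; exact hd' hd
    have h3 : d' ≠ d.swap := by rintro rfl; exact hd' hd.symm
    simp [hd', h1, h2, h3]
  by_cases h2 : d' = d
  · subst h2
    have h1 : ¬ (edgeGraph G).Adj d' d' := SimpleGraph.irrefl _
    have h3 : d' ≠ d'.swap := fun he => hd.ne (congr_arg Prod.fst he)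
    have h4 : ¬ HasShortcut G d' d' := fun h => hd.ne h.1.symm
    have h5 : ¬ HasExchange G d' d' := fun h => h.1 rfl
    simp [hd, h3, h4, h5]
  by_cases h3 : d' = d.swap
  · subst h3
    have h1 : ¬ (edgeGraph G).Adj d d.swap := fun h => h.2.2.2.1 rfl
    have h4 : ¬ HasShortcut G d d.swap := fun h => h.2.1 rfl
    have h5 : ¬ HasShortcut G d.swap d := fun h => h.2.1 rfl
    have h6 : ¬ HasExchange G d d.swap := fun h => h.2.2.1.ne rfl
    simp [hd, hd.symm, h1, h2, h4, h5, h6]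
  have hiff := isTightPair_iff hd hd' h3
  have hadj : (edgeGraph G).Adj d d' ↔
      ¬ HasShortcut G d d' ∧ ¬ HasShortcut G d' d ∧ ¬ HasExchange G d d' := by
    rw [← hiff]
    exact ⟨fun h => h.2.2.2.2, fun h => ⟨hd, hd', Ne.symm h2, h3, h⟩⟩
  have e1 : HasShortcut G d d' → ¬ HasShortcut G d' d := fun h h' => h.2.1 h'.1.symm
  have e2 : HasShortcut G d d' → ¬ HasExchange G d d' := fun h h' => h'.2.2.2.ne h.1.symm
  have e3 : HasShortcut G d' d → ¬ HasExchange G d d' := fun h h' => h'.2.2.1.ne h.1.symm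
  simp only [hd, hd', h2, h3, true_and, if_true, if_false, hadj]
  by_cases f1 : HasShortcut G d d'
  · simp [f1, e1 f1, e2 f1]
  · by_cases f2 : HasShortcut G d' d
    · simp [f1, f2, e3 f2]
    · by_cases f3 : HasExchange G d d' <;> simp [f1, f2, f3]

end TightPairs

/-! ### The edge count in terms of subgraph counts -/

section EdgeCount

variable {V : Type*} [Fintype V] [DecidableEq V]

lemma fromEdgeSet_adj_iff {S : Finset (Sym2 V)} (hS : S ⊆ arcs V) (i j : V) :
    (SimpleGraph.fromEdgeSet (S : Set (Sym2 V))).Adj i j ↔ s(i, j) ∈ S := by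
  rw [SimpleGraph.fromEdgeSet_adj, Finset.mem_coe]
  refine ⟨fun h => h.1, fun h => ⟨h, ?_⟩⟩
  simpa [arcs] using hS h

/-- Every arc is counted in both directions. -/
lemma sum_mem_arcs {S : Finset (Sym2 V)} (hS : S ⊆ arcs V) :
    ∑ d : V × V, (if s(d.1, d.2) ∈ S then (1 : ℝ) else 0) = 2 * S.card := by
  have h1 : ∀ d : V × V, (if s(d.1, d.2) ∈ S then (1 : ℝ) else 0)
      = ∑ e ∈ S, if s(d.1, d.2) = e then 1 else 0 := fun d => by
    rw [Finset.sum_ite_eq]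
  have h2 : ∀ e ∈ S, ∑ d : V × V, (if s(d.1, d.2) = e then (1 : ℝ) else 0) = 2 := by
    intro e he
    have := hS he
    induction e with
    | _ u v =>
    have huv : u ≠ v := by simpa [arcs] using this
    rw [Fintype.sum_prod_type (f := fun d : V × V => if s(d.1, d.2) = s(u, v) then (1 : ℝ) else 0),
      sum_ite_eq_arc huv fun _ _ => (1 : ℝ)]
    norm_num
  rw [Finset.sum_congr rfl fun d _ => h1 d, Finset.sum_comm, Finset.sum_congr rfl h2,
    Finset.sum_const, nsmul_eq_mul, mul_comm]

lemma familyCount_pairs {S : Finset (Sym2 V)} (hS : S ⊆ arcs V) :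
    familyCount (arcs V).offDiag pairArcs S = S.card * (S.card - 1) := by
  have h : ((arcs V).offDiag.filter fun x => pairArcs x ⊆ S) = S.offDiag := by
    ext ⟨a, b⟩
    simp only [Finset.mem_filter, Finset.mem_offDiag, pairArcs, Finset.insert_subset_iff,
      Finset.singleton_subset_iff]
    exact ⟨fun h => ⟨h.2.1, h.2.2, h.1.2.2⟩, fun h => ⟨⟨hS h.1, hS h.2.1, h.2.2⟩, h.1, h.2.1⟩⟩
  rw [familyCount, Finset.sum_boole, h, Finset.offDiag_card, Nat.cast_sub (Nat.le_mul_self _)]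
  push_cast
  ring

open Classical in
lemma sum_hasExchange {S : Finset (Sym2 V)} {G : SimpleGraph V}
    (hG : ∀ i j, G.Adj i j ↔ s(i, j) ∈ S) :
    ∑ d : V × V, ∑ d' : V × V,
      (if G.Adj d.1 d.2 ∧ G.Adj d'.1 d'.2 ∧ HasExchange G d d' then (1 : ℝ) else 0)
      = familyCount (cycles V) cycleArcs S := by
  rw [familyCount, cycles, Finset.sum_filter, ← Fintype.sum_prod_type' (f := fun d d' : V × V =>
    if G.Adj d.1 d.2 ∧ G.Adj d'.1 d'.2 ∧ HasExchange G d d' then (1 : ℝ) else 0)]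
  refine Finset.sum_congr rfl fun t _ => ?_
  rw [← ite_and]
  refine if_congr ?_ rfl rfl
  simp only [cycleArcs, Finset.insert_subset_iff, Finset.singleton_subset_iff, ← hG, HasExchange]
  constructor
  · rintro ⟨h1, h2, h3, h4, h5, h6⟩
    exact ⟨⟨h1.ne, h3, h5.ne, h6.ne.symm, h4, h2.ne⟩, h1, h6.symm, h2, h5.symm⟩
  · rintro ⟨⟨-, h1, -, -, h2, -⟩, h3, h4, h5, h6⟩
    exact ⟨h3, h5, h1, h2, h6.symm, h4.symm⟩

open Classical in
lemma shortcutCount_eq (S : Finset (Sym2 V)) (i l : V) :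
    (shortcutCount S i l : ℝ) = ∑ j, if s(i, j) ∈ S ∧ s(j, l) ∈ S ∧
      (s(i, l) ∈ S ∨ ∃ m, m ≠ j ∧ s(i, m) ∈ S ∧ s(m, l) ∈ S) then 1 else 0 := by
  rw [Finset.sum_boole, shortcutCount]
  congr 1
  split_ifs with h
  · congr 1
    ext j
    simp only [commonNbrs, Finset.mem_filter, Finset.mem_univ, true_and]
    refine ⟨fun hj => ⟨hj.1, hj.2, h.imp_right fun h2 => ?_⟩, fun hj => ⟨hj.1, hj.2.1⟩⟩
    obtain ⟨m, hm, hne⟩ := Finset.exists_mem_ne h2 j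
    simp only [commonNbrs, Finset.mem_filter, Finset.mem_univ, true_and] at hm
    exact ⟨m, hne, hm⟩
  · rw [not_or, not_le] at h
    symm
    rw [Finset.card_eq_zero, Finset.filter_eq_empty_iff]
    rintro j - ⟨h1, h2, h3⟩
    obtain ⟨m, hne, hm⟩ := h3.resolve_left h.1
    refine absurd (Finset.one_lt_card.2 ⟨m, ?_, j, ?_, hne⟩)
      (by omega : ¬ 1 < (commonNbrs S i l).card)
    · simpa [commonNbrs] using hm
    · simpa [commonNbrs] using ⟨h1, h2⟩

open Classical in
lemma sum_hasShortcut {S : Finset (Sym2 V)} {G : SimpleGraph V}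
    (hG : ∀ i j, G.Adj i j ↔ s(i, j) ∈ S) :
    ∑ d : V × V, ∑ d' : V × V,
      (if G.Adj d.1 d.2 ∧ G.Adj d'.1 d'.2 ∧ HasShortcut G d d' then (1 : ℝ) else 0)
      = shortcutPaths S := by
  rw [Fintype.sum_prod_type, shortcutPaths]
  refine Finset.sum_congr rfl fun i _ => ?_
  have h1 : ∀ j l : V, ∑ k : V, (if G.Adj i j ∧ G.Adj k l ∧ HasShortcut G (i, j) (k, l)
      then (1 : ℝ) else 0) = if i ≠ l then (if s(i, j) ∈ S ∧ s(j, l) ∈ S ∧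
      (s(i, l) ∈ S ∨ ∃ m, m ≠ j ∧ s(i, m) ∈ S ∧ s(m, l) ∈ S) then 1 else 0) else 0 := by
    intro j l
    rw [Finset.sum_eq_single j]
    · rw [← ite_and]
      refine if_congr ?_ rfl rfl
      simp only [HasShortcut, hG, true_and]
      tauto
    · intro k _ hk
      rw [if_neg]
      rintro ⟨-, -, h, -⟩
      exact hk h.symm
    · exact fun h => absurd (Finset.mem_univ _) h
  have h2 : ∀ j : V, ∑ d' : V × V, (if G.Adj i j ∧ G.Adj d'.1 d'.2 ∧ HasShortcut G (i, j) d'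
      then (1 : ℝ) else 0) = ∑ l, if i ≠ l then (if s(i, j) ∈ S ∧ s(j, l) ∈ S ∧
      (s(i, l) ∈ S ∨ ∃ m, m ≠ j ∧ s(i, m) ∈ S ∧ s(m, l) ∈ S) then 1 else 0) else 0 := by
    intro j
    rw [Fintype.sum_prod_type, Finset.sum_comm]
    exact Finset.sum_congr rfl fun l _ => h1 j l
  rw [Finset.sum_congr rfl fun j _ => h2 j, Finset.sum_comm]
  refine Finset.sum_congr rfl fun l _ => ?_
  by_cases hil : i = l
  · simp [hil]
  · simp only [ne_eq, hil, not_false_eq_true, if_true]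
    rw [shortcutCount_eq]

/-- The number of edges of the symmetric edge polytope in terms of subgraph counts. -/
lemma sepEdgeCount_fromEdgeSet {S : Finset (Sym2 V)} (hS : S ⊆ arcs V) :
    (sepEdgeCount (SimpleGraph.fromEdgeSet (S : Set (Sym2 V))) : ℝ)
      = pairsMinusCycles V S - shortcutPaths S := by
  classical
  obtain ⟨G, hGS⟩ : ∃ G, G = SimpleGraph.fromEdgeSet (S : Set (Sym2 V)) := ⟨_, rfl⟩
  have hG : ∀ i j, G.Adj i j ↔ s(i, j) ∈ S := hGS ▸ fromEdgeSet_adj_iff hS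
  rw [← hGS]
  have hN : ∑ d : V × V, (if G.Adj d.1 d.2 then (1 : ℝ) else 0) = 2 * S.card := by
    simp only [hG]
    exact sum_mem_arcs hS
  have h2 : 2 * (sepEdgeCount G : ℝ)
      = ∑ d, ∑ d', if (edgeGraph G).Adj d d' then (1 : ℝ) else 0 := by
    have h3 := (edgeGraph G).sum_degrees_eq_twice_card_edges
    rw [sepEdgeCount_eq, Set.ncard_eq_toFinset_card', ← SimpleGraph.edgeFinset]
    have h4 : ∀ d, ∑ d', (if (edgeGraph G).Adj d d' then (1 : ℝ) else 0)
        = (edgeGraph G).degree d := fun d => by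
      rw [Finset.sum_boole, ← SimpleGraph.card_neighborFinset_eq_degree,
        SimpleGraph.neighborFinset_eq_filter]
    rw [Finset.sum_congr rfl fun d _ => h4 d]
    exact_mod_cast h3.symm
  simp only [edgeGraph_adj_indicator, Finset.sum_sub_distrib, Finset.sum_ite_eq', Finset.mem_univ,
    if_true] at h2
  rw [← Finset.sum_mul_sum, hN, sum_hasExchange hG, sum_hasShortcut hG, Finset.sum_comm
    (f := fun d d' : V × V =>
      if G.Adj d'.1 d'.2 ∧ G.Adj d.1 d.2 ∧ HasShortcut G d' d then (1 : ℝ) else 0),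
    sum_hasShortcut hG] at h2
  rw [pairsMinusCycles, familyCount_pairs hS]
  linarith

end EdgeCount

/-! ### The variance as a finite sum -/

section BinomialRandomGraph

lemma measurableSingletonClass_simpleGraph (V : Type*) [Countable V] :
    MeasurableSingletonClass (SimpleGraph V) where
  measurableSet_singleton G := by
    have h : ({G} : Set (SimpleGraph V)) = SimpleGraph.edgeSet ⁻¹' {G.edgeSet} := by
      ext G'
      simp
    rw [h]
    exact SimpleGraph.measurable_edgeSet (measurableSet_singleton _)

variable {V : Type*} [Fintype V] [DecidableEq V]

lemma binomialRandom_real_singleton (p : unitInterval) {S : Finset (Sym2 V)} (hS : S ⊆ arcs V) :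
    (SimpleGraph.binomialRandom V p).real {SimpleGraph.fromEdgeSet (S : Set (Sym2 V))}
      = (p : ℝ) ^ S.card * (1 - (p : ℝ)) ^ ((arcs V).card - S.card) := by
  have h1 : (SimpleGraph.fromEdgeSet (S : Set (Sym2 V))).edgeSet = S := by
    rw [SimpleGraph.edgeSet_fromEdgeSet, sdiff_eq_left, Set.disjoint_left]
    intro e he hd
    have := hS (Finset.mem_coe.1 he)
    simp only [arcs, Finset.mem_filter, Finset.mem_univ, true_and] at this
    exact this hd
  have h2 : (arcs V).card = (Nat.card V).choose 2 := by
    rw [Nat.card_eq_fintype_card, ← Sym2.card_subtype_not_diag, Fintype.card_subtype, arcs]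
  rw [Measure.real, SimpleGraph.binomialRandom_singleton, h1, Set.ncard_coe_finset, h2]
  rw [ENNReal.toReal_mul, ENNReal.toReal_pow, ENNReal.toReal_pow, ENNReal.coe_toReal,
    ENNReal.coe_toReal, unitInterval.coe_toNNReal, unitInterval.coe_toNNReal,
    unitInterval.coe_symm_eq]

lemma integral_binomialRandom (p : unitInterval) (f : SimpleGraph V → ℝ) :
    ∫ G, f G ∂(SimpleGraph.binomialRandom V p)
      = bernExp p (arcs V) (fun S => f (SimpleGraph.fromEdgeSet (S : Set (Sym2 V)))) := by
  have := measurableSingletonClass_simpleGraph V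
  rw [integral_fintype Integrable.of_finite, bernExp]
  symm
  refine Finset.sum_nbij' (fun S => SimpleGraph.fromEdgeSet (S : Set (Sym2 V)))
    (fun G => (Set.toFinite G.edgeSet).toFinset) (fun _ _ => Finset.mem_univ _)
    (fun G _ => ?_) (fun S hS => ?_)
    (fun G _ => ?_) (fun S hS => ?_)
  · rw [Finset.mem_powerset]
    intro e he
    rw [Set.Finite.mem_toFinset] at he
    simpa [arcs] using G.not_isDiag_of_mem_edgeSet he
  · rw [Finset.mem_powerset] at hS
    ext e
    induction e with
    | _ u v =>
    rw [Set.Finite.mem_toFinset, SimpleGraph.mem_edgeSet, fromEdgeSet_adj_iff hS]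
  · simp
  · rw [binomialRandom_real_singleton p (Finset.mem_powerset.1 hS), smul_eq_mul]

lemma sepEdgeVariance_eq (n : ℕ) (p : unitInterval) :
    sepEdgeVariance n p
      = bernVar p (arcs (Fin n)) (fun S => pairsMinusCycles (Fin n) S - shortcutPaths S) := by
  have := measurableSingletonClass_simpleGraph (Fin n)
  rw [sepEdgeVariance, variance_eq_sub MemLp.of_discrete]
  have h := bernVar_congr (p := p) fun S (hS : S ⊆ arcs (Fin n)) => sepEdgeCount_fromEdgeSet hS
  rw [← h, bernVar, integral_binomialRandom, integral_binomialRandom]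
  rfl

end BinomialRandomGraph

/-! ### Two-sided bounds for the variance -/

section VarianceBounds

/-- The order of magnitude of the variance for edge probability `p` and `n` nodes. -/
noncomputable def varianceOrder (n p : ℝ) : ℝ :=
  n ^ 6 * p ^ 3 * (1 - p) * (1 - √2 * p) ^ 2 + n ^ 5 * p ^ 3 * (1 - p) + n ^ 4 * p ^ 2 * (1 - p)

lemma one_fourth_le_sq_one_sub_sqrt_two_mul {p : ℝ} (hp1 : p ≤ 1 / 3) :
    1 / 4 ≤ (1 - √2 * p) ^ 2 := by
  have h1 := sqrt_two_bounds
  have h2 : √2 * p ≤ 1 / 2 := by nlinarith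
  nlinarith

lemma one_sixteenth_le_sq_one_sub_sqrt_two_mul {p : ℝ} (hp : 9 / 10 ≤ p) :
    1 / 16 ≤ (1 - √2 * p) ^ 2 := by
  have h1 := sqrt_two_bounds
  have h2 : 5 / 4 ≤ √2 * p := by nlinarith
  nlinarith

lemma sq_one_sub_sqrt_two_mul_le_one {p : ℝ} (hp0 : 0 ≤ p) (hp1 : p ≤ 1) :
    (1 - √2 * p) ^ 2 ≤ 1 := by
  have h1 := sqrt_two_bounds
  have h2 : √2 * p ≤ 2 := by nlinarith
  have h3 : 0 ≤ √2 * p := by positivity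
  nlinarith

lemma varianceOrder_nonneg {n p : ℝ} (hn : 0 ≤ n) (hp0 : 0 ≤ p) (hp1 : p ≤ 1) :
    0 ≤ varianceOrder n p := by
  have hq : 0 ≤ 1 - p := sub_nonneg.2 hp1
  unfold varianceOrder
  positivity

/-- Three regimes: for small `p` and for `p` near `1` the leading term does not vanish; in between,
the second-order coefficients take over. -/
lemma varianceOrder_le_bernVar_pairsMinusCycles {V : Type*} [Fintype V] [DecidableEq V] {p : ℝ}
    (hp0 : 0 ≤ p) (hp1 : p ≤ 1) (hn : 288 ≤ (Fintype.card V : ℝ)) :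
    varianceOrder (Fintype.card V) p
      ≤ 14000000 * bernVar p (arcs V) (pairsMinusCycles V) := by
  have hq : 0 ≤ 1 - p := sub_nonneg.2 hp1
  have hV := bernVar_nonneg (U := arcs V) hp0 hp1 (pairsMinusCycles V)
  have h1 := bernVar_pairsMinusCycles_ge_first hp0 hp1 hn
  unfold varianceOrder
  set n : ℝ := (Fintype.card V : ℝ)
  set W := bernVar p (arcs V) (pairsMinusCycles V)
  have hX : 0 ≤ n ^ 5 * p ^ 3 * (1 - p) := by positivity
  rcases le_total p (1 / 3) with h3 | h3
  · have h2 := bernVar_pairsMinusCycles_ge_of_le hp0 h3 hn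
    have h4 : n ^ 4 * p ^ 3 * (1 - p) ≤ n ^ 4 * p ^ 2 * (1 - p) := by
      calc n ^ 4 * p ^ 3 * (1 - p) = p * (n ^ 4 * p ^ 2 * (1 - p)) := by ring
        _ ≤ _ := mul_le_of_le_one_left (by positivity) hp1
    have h5 : n ^ 5 * p ^ 3 * (1 - p) ≤ 4 * (n ^ 6 * p ^ 3 * (1 - p) * (1 - √2 * p) ^ 2) := by
      have h6 : 1 ≤ n * (4 * (1 - √2 * p) ^ 2) :=
        one_le_mul_of_one_le_of_one_le (by linarith)
          (by linarith [one_fourth_le_sq_one_sub_sqrt_two_mul h3])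
      calc n ^ 5 * p ^ 3 * (1 - p)
          ≤ n ^ 5 * p ^ 3 * (1 - p) * (n * (4 * (1 - √2 * p) ^ 2)) :=
            le_mul_of_one_le_right hX h6
        _ = _ := by ring
    linarith
  · have e1 : n ^ 4 * p ^ 3 * (1 - p) ≤ n ^ 5 * p ^ 2 * (1 - p) := by
      calc n ^ 4 * p ^ 3 * (1 - p) = p * (n ^ 4 * p ^ 2 * (1 - p)) := by ring
        _ ≤ n * (n ^ 4 * p ^ 2 * (1 - p)) :=
            mul_le_mul_of_nonneg_right (by linarith) (by positivity)
        _ = _ := by ring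
    have e2 : n ^ 4 * p ^ 2 * (1 - p) ≤ n ^ 5 * p ^ 2 * (1 - p) := by
      calc n ^ 4 * p ^ 2 * (1 - p) ≤ n * (n ^ 4 * p ^ 2 * (1 - p)) :=
            le_mul_of_one_le_left (by positivity) (by linarith)
        _ = _ := by ring
    have e3 : n ^ 5 * p ^ 3 * (1 - p) ≤ n ^ 5 * p ^ 2 * (1 - p) := by
      calc n ^ 5 * p ^ 3 * (1 - p) = p * (n ^ 5 * p ^ 2 * (1 - p)) := by ring
        _ ≤ _ := mul_le_of_le_one_left (by positivity) hp1
    rcases le_total p (9 / 10) with h4 | h4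
    · have h2 := bernVar_pairsMinusCycles_ge_of_ge h3 hp1 hn
      have h5 : n ^ 5 * p ^ 2 * (1 - p) ≤ 10 * (n ^ 5 * p ^ 2 * (1 - p) ^ 2) := by
        calc n ^ 5 * p ^ 2 * (1 - p) ≤ n ^ 5 * p ^ 2 * (1 - p) * (10 * (1 - p)) :=
              le_mul_of_one_le_right (by positivity) (by linarith)
          _ = _ := by ring
      linarith
    · have h5 := one_sixteenth_le_sq_one_sub_sqrt_two_mul h4
      set A := n ^ 6 * p ^ 3 * (1 - p) * (1 - √2 * p) ^ 2
      have h6 : n ^ 6 * p ^ 3 * (1 - p) ≤ 16 * A := by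
        have : n ^ 6 * p ^ 3 * (1 - p) * (1 / 16) ≤ A :=
          mul_le_mul_of_nonneg_left h5 (by positivity)
        linarith
      have h7 : 288 * (n ^ 5 * p ^ 3 * (1 - p)) ≤ n ^ 6 * p ^ 3 * (1 - p) := by
        calc _ ≤ n * (n ^ 5 * p ^ 3 * (1 - p)) := mul_le_mul_of_nonneg_right hn hX
          _ = _ := by ring
      have h8 : 288 * (n ^ 4 * p ^ 3 * (1 - p)) ≤ n ^ 5 * p ^ 3 * (1 - p) := by
        calc _ ≤ n * (n ^ 4 * p ^ 3 * (1 - p)) := mul_le_mul_of_nonneg_right hn (by positivity)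
          _ = _ := by ring
      have h9 : n ^ 4 * p ^ 2 * (1 - p) ≤ 3 * (n ^ 4 * p ^ 3 * (1 - p)) := by
        calc _ ≤ n ^ 4 * p ^ 2 * (1 - p) * (3 * p) :=
              le_mul_of_one_le_right (by positivity) (by linarith)
          _ = _ := by ring
      linarith

lemma bernVar_shortcutPaths_le_varianceOrder {V : Type*} [Fintype V] [DecidableEq V] {p : ℝ}
    (hp0 : 0 ≤ p) (hp1 : p ≤ 1) :
    (Fintype.card V : ℝ) * bernVar p (arcs V) shortcutPaths
      ≤ 50 * varianceOrder (Fintype.card V) p := by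
  have hq : 0 ≤ 1 - p := sub_nonneg.2 hp1
  unfold varianceOrder
  set n : ℝ := (Fintype.card V : ℝ)
  have hn : 0 ≤ n := Nat.cast_nonneg _
  have hA : 0 ≤ n ^ 6 * p ^ 3 * (1 - p) * (1 - √2 * p) ^ 2 := by positivity
  calc n * bernVar p (arcs V) shortcutPaths
      ≤ n * (50 * (n ^ 3 * p ^ 2 * (1 - p) + n ^ 4 * p ^ 3 * (1 - p))) :=
        mul_le_mul_of_nonneg_left (bernVar_shortcutPaths_le hp0 hp1) hn
    _ = 50 * (n ^ 5 * p ^ 3 * (1 - p) + n ^ 4 * p ^ 2 * (1 - p)) := by ring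
    _ ≤ _ := by linarith

/-- The variance of the number of edges is of the order `varianceOrder`, uniformly in `p`: the
shortcut paths contribute a factor `n` less than the polynomial part. -/
lemma sepEdgeVariance_bounds {n : ℕ} (hn : 2800000000 ≤ (n : ℝ)) (p : unitInterval) :
    varianceOrder n p ≤ 56000000 * sepEdgeVariance n p ∧
      sepEdgeVariance n p ≤ 3300 * varianceOrder n p := by
  have hp0 : 0 ≤ (p : ℝ) := p.2.1
  have hp1 : (p : ℝ) ≤ 1 := p.2.2
  have hcard : (Fintype.card (Fin n) : ℝ) = n := by rw [Fintype.card_fin]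
  have h1 := varianceOrder_le_bernVar_pairsMinusCycles (V := Fin n) hp0 hp1
    (by rw [hcard]; linarith)
  have h2 := bernVar_shortcutPaths_le_varianceOrder (V := Fin n) hp0 hp1
  have h3 := bernVar_pairsMinusCycles_le (V := Fin n) hp0 hp1 (by rw [hcard]; linarith)
  have h4 := bernVar_sub_le (U := arcs (Fin n)) hp0 hp1 (pairsMinusCycles (Fin n)) shortcutPaths
  have h5 := bernVar_add_le (U := arcs (Fin n)) hp0 hp1
    (fun S => pairsMinusCycles (Fin n) S - shortcutPaths S) shortcutPaths
  simp only [sub_add_cancel] at h5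
  have h6 := bernVar_nonneg (U := arcs (Fin n)) hp0 hp1 shortcutPaths
  rw [← sepEdgeVariance_eq] at h4 h5
  rw [hcard] at h1 h2 h3
  change bernVar p (arcs (Fin n)) (pairsMinusCycles (Fin n)) ≤ 1600 * varianceOrder n p at h3
  change _ ≤ 2 * sepEdgeVariance n p + _ at h5
  change bernVar p (arcs (Fin n)) (pairsMinusCycles (Fin n)) ≤ _ at h5
  -- Since `50 / 2800000000 = 1 / (4 * 14000000)`, the shortcut paths absorb at most half of the
  -- lower bound.
  have h7 : 2800000000 * bernVar p (arcs (Fin n)) shortcutPaths ≤ 50 * varianceOrder n p :=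
    (mul_le_mul_of_nonneg_right hn h6).trans h2
  constructor <;> linarith

end VarianceBounds

/-! ### Asymptotics -/

section Asymptotics

lemma isTheta_of_bounds {f g : ℕ → ℝ} {a b : ℝ} (hg : ∀ᶠ n in atTop, 0 ≤ g n)
    (hf : ∀ᶠ n in atTop, 0 ≤ f n) (h1 : ∀ᶠ n in atTop, g n ≤ a * f n)
    (h2 : ∀ᶠ n in atTop, f n ≤ b * g n) : f =Θ[atTop] g := by
  refine ⟨IsBigO.of_bound b ?_, IsBigO.of_bound a ?_⟩
  · filter_upwards [hg, hf, h2] with n h3 h4 h5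
    rwa [Real.norm_of_nonneg h3, Real.norm_of_nonneg h4]
  · filter_upwards [hg, hf, h1] with n h3 h4 h5
    rwa [Real.norm_of_nonneg h3, Real.norm_of_nonneg h4]

/-- `u` dominates `n ^ (-k)` exactly if `n ^ k * u n` tends to infinity. -/
lemma isLittleO_zpow_neg_iff (k : ℕ) {u : ℕ → ℝ} (hu : ∀ n, 0 ≤ u n) :
    (fun n : ℕ => (n : ℝ) ^ (-(k : ℤ))) =o[atTop] u
      ↔ Tendsto (fun n : ℕ => (n : ℝ) ^ k * u n) atTop atTop := by
  have key : ∀ n : ℕ, 0 < n → ∀ c : ℝ, 0 < c →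
      (‖(n : ℝ) ^ (-(k : ℤ))‖ ≤ c * ‖u n‖ ↔ 1 / c ≤ (n : ℝ) ^ k * u n) := by
    intro n hn c hc
    have hn' : (0 : ℝ) < (n : ℝ) ^ k := by positivity
    rw [zpow_neg, zpow_natCast, Real.norm_of_nonneg (inv_nonneg.2 hn'.le),
      Real.norm_of_nonneg (hu n), inv_le_iff_one_le_mul₀ hn', div_le_iff₀ hc]
    constructor <;> intro h <;> linarith
  rw [isLittleO_iff, tendsto_atTop]
  constructor
  · intro h b
    have hc : 0 < 1 / (|b| + 1) := by positivity
    filter_upwards [h hc, eventually_gt_atTop 0] with n h1 hn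
    have h2 := (key n hn _ hc).1 h1
    rw [one_div_one_div] at h2
    linarith [le_abs_self b]
  · intro h c hc
    filter_upwards [h (1 / c), eventually_gt_atTop 0] with n h1 hn
    exact (key n hn c hc).2 h1

lemma tendsto_varianceOrder_iff {p : ℕ → ℝ} (hp : ∀ n, 0 < p n ∧ p n < 1) :
    Tendsto (fun n : ℕ => varianceOrder n (p n)) atTop atTop ↔
      Tendsto (fun n : ℕ => (n : ℝ) ^ 2 * p n) atTop atTop ∧
        Tendsto (fun n : ℕ => (n : ℝ) ^ 6 * (1 - p n)) atTop atTop := by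
  constructor
  · intro h
    rw [tendsto_atTop] at h
    constructor
    · rw [tendsto_atTop]
      intro b
      filter_upwards [h (3 * (|b| + 1) ^ 3), eventually_ge_atTop 1] with n h1 hn
      obtain ⟨hp0, hp1⟩ := hp n
      set x := p n
      have hn' : (1 : ℝ) ≤ n := by exact_mod_cast hn
      by_contra hlt
      have hy : (n : ℝ) ^ 2 * x < |b| + 1 := by linarith [le_abs_self b]
      have hy0 : 0 < (n : ℝ) ^ 2 * x := by positivity
      have h2 : (n : ℝ) ^ 6 * x ^ 3 * (1 - x) * (1 - √2 * x) ^ 2 ≤ ((n : ℝ) ^ 2 * x) ^ 3 := by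
        have h3 : (1 - x) * (1 - √2 * x) ^ 2 ≤ 1 :=
          mul_le_one₀ (by linarith) (sq_nonneg _) (sq_one_sub_sqrt_two_mul_le_one hp0.le hp1.le)
        calc _ = ((n : ℝ) ^ 2 * x) ^ 3 * ((1 - x) * (1 - √2 * x) ^ 2) := by ring
          _ ≤ _ := mul_le_of_le_one_right (by positivity) h3
      have h4 : (n : ℝ) ^ 5 * x ^ 3 * (1 - x) ≤ ((n : ℝ) ^ 2 * x) ^ 3 := by
        calc (n : ℝ) ^ 5 * x ^ 3 * (1 - x) ≤ (n : ℝ) ^ 5 * x ^ 3 * n :=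
              mul_le_mul_of_nonneg_left (by linarith) (by positivity)
          _ = _ := by ring
      have h5 : (n : ℝ) ^ 4 * x ^ 2 * (1 - x) ≤ ((n : ℝ) ^ 2 * x) ^ 2 := by
        calc _ = ((n : ℝ) ^ 2 * x) ^ 2 * (1 - x) := by ring
          _ ≤ _ := mul_le_of_le_one_right (by positivity) (by linarith)
      have h6 : ((n : ℝ) ^ 2 * x) ^ 3 < (|b| + 1) ^ 3 :=
        pow_lt_pow_left₀ hy hy0.le (by norm_num)
      have h7 : ((n : ℝ) ^ 2 * x) ^ 2 < (|b| + 1) ^ 2 :=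
        pow_lt_pow_left₀ hy hy0.le (by norm_num)
      have h8 : (|b| + 1) ^ 2 ≤ (|b| + 1) ^ 3 :=
        pow_le_pow_right₀ (by linarith [abs_nonneg b]) (by norm_num)
      unfold varianceOrder at h1
      linarith
    · rw [tendsto_atTop]
      intro b
      filter_upwards [h (3 * b), eventually_ge_atTop 1] with n h1 hn
      obtain ⟨hp0, hp1⟩ := hp n
      set x := p n
      have hn' : (1 : ℝ) ≤ n := by exact_mod_cast hn
      have hq : 0 < 1 - x := by linarith
      have hX : 0 ≤ (n : ℝ) ^ 6 * (1 - x) := by positivity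
      have h2 : (n : ℝ) ^ 6 * x ^ 3 * (1 - x) * (1 - √2 * x) ^ 2 ≤ (n : ℝ) ^ 6 * (1 - x) := by
        have h3 : x ^ 3 * (1 - √2 * x) ^ 2 ≤ 1 :=
          mul_le_one₀ (pow_le_one₀ hp0.le hp1.le) (sq_nonneg _)
            (sq_one_sub_sqrt_two_mul_le_one hp0.le hp1.le)
        calc _ = (n : ℝ) ^ 6 * (1 - x) * (x ^ 3 * (1 - √2 * x) ^ 2) := by ring
          _ ≤ _ := mul_le_of_le_one_right hX h3
      have h4 : (n : ℝ) ^ 5 * x ^ 3 * (1 - x) ≤ (n : ℝ) ^ 6 * (1 - x) := by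
        have h5 : (n : ℝ) ^ 5 * x ^ 3 ≤ (n : ℝ) ^ 6 * 1 :=
          mul_le_mul (pow_le_pow_right₀ hn' (by norm_num)) (pow_le_one₀ hp0.le hp1.le)
            (by positivity) (by positivity)
        rw [mul_one] at h5
        exact mul_le_mul_of_nonneg_right h5 hq.le
      have h6 : (n : ℝ) ^ 4 * x ^ 2 * (1 - x) ≤ (n : ℝ) ^ 6 * (1 - x) := by
        have h7 : (n : ℝ) ^ 4 * x ^ 2 ≤ (n : ℝ) ^ 6 * 1 :=
          mul_le_mul (pow_le_pow_right₀ hn' (by norm_num)) (pow_le_one₀ hp0.le hp1.le)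
            (by positivity) (by positivity)
        rw [mul_one] at h7
        exact mul_le_mul_of_nonneg_right h7 hq.le
      unfold varianceOrder at h1
      linarith
  · rintro ⟨h1, h2⟩
    rw [tendsto_atTop] at *
    intro b
    filter_upwards [h1 (6 * (|b| + 1)), h2 (32 * (|b| + 1)),
      (tendsto_natCast_atTop_atTop (R := ℝ)).eventually_ge_atTop (270 * (|b| + 1))]
      with n h3 h4 h5
    obtain ⟨hp0, hp1⟩ := hp n
    set x := p n
    have hb : 1 ≤ |b| + 1 := by linarith [abs_nonneg b]
    have hbb : b ≤ |b| + 1 := by linarith [le_abs_self b]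
    have hn' : (1 : ℝ) ≤ n := by linarith
    have hq : 0 < 1 - x := by linarith
    have hA : 0 ≤ (n : ℝ) ^ 6 * x ^ 3 * (1 - x) * (1 - √2 * x) ^ 2 := by positivity
    have hB : 0 ≤ (n : ℝ) ^ 5 * x ^ 3 * (1 - x) := by positivity
    have hC : 0 ≤ (n : ℝ) ^ 4 * x ^ 2 * (1 - x) := by positivity
    unfold varianceOrder
    -- The leading term suffices unless `x` is near `1 / √2`, where the second term is of order
    -- `n ^ 5`.
    rcases le_total x (1 / 3) with h6 | h6
    · have h7 : ((n : ℝ) ^ 2 * x) ^ 3 * (1 / 6)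
          ≤ (n : ℝ) ^ 6 * x ^ 3 * (1 - x) * (1 - √2 * x) ^ 2 := by
        have h8 : 2 / 3 * (1 / 4) ≤ (1 - x) * (1 - √2 * x) ^ 2 :=
          mul_le_mul (by linarith) (one_fourth_le_sq_one_sub_sqrt_two_mul h6) (by norm_num) hq.le
        calc ((n : ℝ) ^ 2 * x) ^ 3 * (1 / 6)
            ≤ ((n : ℝ) ^ 2 * x) ^ 3 * ((1 - x) * (1 - √2 * x) ^ 2) :=
              mul_le_mul_of_nonneg_left (by linarith) (by positivity)
          _ = _ := by ring
      have h9 : (n : ℝ) ^ 2 * x ≤ ((n : ℝ) ^ 2 * x) ^ 3 :=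
        le_self_pow₀ (by linarith) (by norm_num)
      linarith
    · rcases le_total x (9 / 10) with h7 | h7
      · have h8 : (n : ℝ) * (1 / 270) ≤ (n : ℝ) ^ 5 * x ^ 3 * (1 - x) := by
          have h9 : (1 / 27 : ℝ) ≤ x ^ 3 := by
            calc (1 / 27 : ℝ) = (1 / 3) ^ 3 := by norm_num
              _ ≤ _ := pow_le_pow_left₀ (by norm_num) h6 3
          have h10 : (1 / 27 : ℝ) * (1 / 10) ≤ x ^ 3 * (1 - x) :=
            mul_le_mul h9 (by linarith) (by norm_num) (by positivity)
          calc (n : ℝ) * (1 / 270) ≤ (n : ℝ) ^ 5 * (x ^ 3 * (1 - x)) :=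
                mul_le_mul (le_self_pow₀ hn' (by norm_num)) (by linarith) (by norm_num)
                  (by positivity)
            _ = _ := by ring
        linarith
      · have h8 : (n : ℝ) ^ 6 * (1 - x) * (1 / 32)
            ≤ (n : ℝ) ^ 6 * x ^ 3 * (1 - x) * (1 - √2 * x) ^ 2 := by
          have h9 : (1 / 2 : ℝ) ≤ x ^ 3 := by
            calc (1 / 2 : ℝ) ≤ (9 / 10) ^ 3 := by norm_num
              _ ≤ _ := pow_le_pow_left₀ (by norm_num) h7 3
          have h10 : (1 / 2 : ℝ) * (1 / 16) ≤ x ^ 3 * (1 - √2 * x) ^ 2 :=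
            mul_le_mul h9 (one_sixteenth_le_sq_one_sub_sqrt_two_mul h7) (by norm_num)
              (by positivity)
          calc (n : ℝ) ^ 6 * (1 - x) * (1 / 32)
              ≤ (n : ℝ) ^ 6 * (1 - x) * (x ^ 3 * (1 - √2 * x) ^ 2) :=
                mul_le_mul_of_nonneg_left (by linarith) (by positivity)
            _ = _ := by ring
        linarith

end Asymptotics

theorem mainTheorem3 (p : ℕ → unitInterval) (hp : ∀ n, 0 < (p n : ℝ) ∧ (p n : ℝ) < 1) :
    ((fun n : ℕ => sepEdgeVariance n (p n)) =Θ[atTop] (fun n : ℕ =>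
        (n : ℝ) ^ 6 * (p n : ℝ) ^ 3 * (1 - (p n : ℝ)) * (1 - √2 * (p n : ℝ)) ^ 2
          + (n : ℝ) ^ 5 * (p n : ℝ) ^ 3 * (1 - (p n : ℝ))
          + (n : ℝ) ^ 4 * (p n : ℝ) ^ 2 * (1 - (p n : ℝ)))) ∧
    ((fun n : ℕ => (n : ℝ) ^ (-2 : ℤ)) =o[atTop] (fun n : ℕ => (p n : ℝ)) →
      (fun n : ℕ => sepEdgeVariance n (p n)) =Θ[atTop] (fun n : ℕ =>
        (n : ℝ) ^ 6 * (p n : ℝ) ^ 3 * (1 - (p n : ℝ)) * (1 - √2 * (p n : ℝ)) ^ 2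
          + (n : ℝ) ^ 5 * (p n : ℝ) ^ 3 * (1 - (p n : ℝ)))) ∧
    ((fun n : ℕ => (p n : ℝ)) =O[atTop] (fun n : ℕ => (n : ℝ) ^ (-2 : ℤ)) →
      (fun n : ℕ => sepEdgeVariance n (p n)) =Θ[atTop] (fun n : ℕ =>
        (n : ℝ) ^ 4 * (p n : ℝ) ^ 2)) ∧
    ((∀ n, (p n : ℝ) = 1 / √2) →
      (fun n : ℕ => sepEdgeVariance n (p n)) =Θ[atTop] (fun n : ℕ => (n : ℝ) ^ 5)) ∧
    (Tendsto (fun n : ℕ => sepEdgeVariance n (p n)) atTop atTop ↔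
      (fun n : ℕ => (n : ℝ) ^ (-2 : ℤ)) =o[atTop] (fun n : ℕ => (p n : ℝ)) ∧
      (fun n : ℕ => (n : ℝ) ^ (-6 : ℤ)) =o[atTop] (fun n : ℕ => 1 - (p n : ℝ))) := by
  have hbounds : ∀ᶠ n : ℕ in atTop, varianceOrder n (p n) ≤ 56000000 * sepEdgeVariance n (p n) ∧
      sepEdgeVariance n (p n) ≤ 3300 * varianceOrder n (p n) := by
    filter_upwards [(tendsto_natCast_atTop_atTop (R := ℝ)).eventually_ge_atTop 2800000000]
      with n hn
    exact sepEdgeVariance_bounds hn (p n)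
  have hq : ∀ n, 0 < 1 - (p n : ℝ) := fun n => sub_pos.2 (hp n).2
  have hp0 : ∀ n, 0 ≤ (p n : ℝ) := fun n => (hp n).1.le
  have hnonneg : ∀ n : ℕ, 0 ≤ varianceOrder n (p n) := fun n =>
    varianceOrder_nonneg (Nat.cast_nonneg n) (hp0 n) (hp n).2.le
  have hnonneg' : ∀ᶠ n : ℕ in atTop, 0 ≤ sepEdgeVariance n (p n) := by
    filter_upwards [hbounds] with n hn
    linarith [hnonneg n, hn.1]
  have htheta : (fun n : ℕ => sepEdgeVariance n (p n)) =Θ[atTop]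
      (fun n : ℕ => varianceOrder n (p n)) :=
    isTheta_of_bounds (Eventually.of_forall hnonneg) hnonneg' (hbounds.mono fun _ h => h.1)
      (hbounds.mono fun _ h => h.2)
  have hlarge : ((fun n : ℕ => (n : ℝ) ^ (-2 : ℤ)) =o[atTop] fun n : ℕ => (p n : ℝ)) ↔
      Tendsto (fun n : ℕ => (n : ℝ) ^ 2 * (p n : ℝ)) atTop atTop :=
    isLittleO_zpow_neg_iff 2 hp0
  have hlarge' : ((fun n : ℕ => (n : ℝ) ^ (-6 : ℤ)) =o[atTop] fun n : ℕ => 1 - (p n : ℝ)) ↔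
      Tendsto (fun n : ℕ => (n : ℝ) ^ 6 * (1 - (p n : ℝ))) atTop atTop :=
    isLittleO_zpow_neg_iff 6 fun n => (hq n).le
  have hA : ∀ n : ℕ, 0 ≤ (n : ℝ) ^ 6 * (p n : ℝ) ^ 3 * (1 - (p n : ℝ))
      * (1 - √2 * (p n : ℝ)) ^ 2 := fun n => by
    have := hq n; have := hp0 n; positivity
  have hB : ∀ n : ℕ, 0 ≤ (n : ℝ) ^ 5 * (p n : ℝ) ^ 3 * (1 - (p n : ℝ)) := fun n => by
    have := hq n; have := hp0 n; positivity
  have hC : ∀ n : ℕ, 0 ≤ (n : ℝ) ^ 4 * (p n : ℝ) ^ 2 * (1 - (p n : ℝ)) := fun n => by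
    have := hq n; have := hp0 n; positivity
  refine ⟨htheta, fun h => htheta.trans ?_, fun h => htheta.trans ?_, fun h => htheta.trans ?_, ?_⟩
  · rw [hlarge] at h
    refine isTheta_of_bounds (a := 1) (b := 5)
      (Eventually.of_forall fun n => add_nonneg (hA n) (hB n)) (Eventually.of_forall hnonneg)
      (Eventually.of_forall fun n => ?_) ?_
    · have := hC n
      unfold varianceOrder
      linarith
    · filter_upwards [h.eventually_ge_atTop 1, eventually_ge_atTop 3] with n h1 hn
      have hn' : (3 : ℝ) ≤ n := by exact_mod_cast hn
      have h2 := hA n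
      have h3 := hB n
      have h4 := hC n
      have h5 := hp0 n
      unfold varianceOrder
      set x : ℝ := (p n : ℝ)
      rcases le_total x (1 / 3) with h6 | h6
      · have h7 : 1 ≤ (n : ℝ) ^ 2 * x * (4 * (1 - √2 * x) ^ 2) :=
          one_le_mul_of_one_le_of_one_le h1 (by linarith [one_fourth_le_sq_one_sub_sqrt_two_mul h6])
        have h8 := le_mul_of_one_le_right h4 h7
        have h9 : (n : ℝ) ^ 4 * x ^ 2 * (1 - x) * ((n : ℝ) ^ 2 * x * (4 * (1 - √2 * x) ^ 2))
            = 4 * ((n : ℝ) ^ 6 * x ^ 3 * (1 - x) * (1 - √2 * x) ^ 2) := by ring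
        linarith
      · have h7 : 1 ≤ (n : ℝ) * x := by nlinarith
        have h8 := le_mul_of_one_le_right h4 h7
        have h9 : (n : ℝ) ^ 4 * x ^ 2 * (1 - x) * ((n : ℝ) * x)
            = (n : ℝ) ^ 5 * x ^ 3 * (1 - x) := by ring
        linarith
  · obtain ⟨c, hc, hO⟩ := h.exists_pos
    have hO' : ∀ᶠ n : ℕ in atTop, (n : ℝ) ^ 2 * (p n : ℝ) ≤ c := by
      filter_upwards [hO.bound, eventually_gt_atTop 0] with n h1 hn
      have hn' : (0 : ℝ) < (n : ℝ) ^ 2 := by positivity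
      have h2 : (n : ℝ) ^ (-2 : ℤ) = ((n : ℝ) ^ 2)⁻¹ := by
        rw [zpow_neg]; norm_cast
      rw [h2, Real.norm_of_nonneg (hp0 n), Real.norm_of_nonneg (inv_nonneg.2 hn'.le),
        ← div_eq_mul_inv, le_div_iff₀ hn'] at h1
      linarith
    have hD : ∀ n : ℕ, 0 ≤ (n : ℝ) ^ 4 * (p n : ℝ) ^ 2 := fun n => by positivity
    refine isTheta_of_bounds (a := 2) (b := 2 * c + 1) (Eventually.of_forall hD)
      (Eventually.of_forall hnonneg) ?_ ?_
    · filter_upwards [hO', (tendsto_natCast_atTop_atTop (R := ℝ)).eventually_ge_atTop (2 * c + 1)]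
        with n h1 hn
      have h2 := hA n
      have h3 := hB n
      have h4 := hD n
      have h5 := hp0 n
      unfold varianceOrder
      set x : ℝ := (p n : ℝ)
      have h6 : x ≤ 1 / 2 := by
        by_contra hlt
        have h7 : (n : ℝ) * 1 ≤ (n : ℝ) * n := mul_le_mul_of_nonneg_left (by linarith) (by linarith)
        nlinarith
      have h7 := mul_le_mul_of_nonneg_left (show 1 / 2 ≤ 1 - x by linarith) h4
      linarith
    · filter_upwards [hO', eventually_ge_atTop 1] with n h1 hn
      have hn' : (1 : ℝ) ≤ n := by exact_mod_cast hn
      have h2 := hD n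
      have h3 := hp0 n
      have h4 := hq n
      have h5 := sq_one_sub_sqrt_two_mul_le_one h3 (hp n).2.le
      unfold varianceOrder
      set x : ℝ := (p n : ℝ)
      have h6 : (1 - x) * (1 - √2 * x) ^ 2 ≤ 1 := mul_le_one₀ (by linarith) (sq_nonneg _) h5
      have h7 : (n : ℝ) ^ 6 * x ^ 3 * (1 - x) * (1 - √2 * x) ^ 2 ≤ c * ((n : ℝ) ^ 4 * x ^ 2) := by
        calc _ = (n : ℝ) ^ 2 * x * ((n : ℝ) ^ 4 * x ^ 2) * ((1 - x) * (1 - √2 * x) ^ 2) := by ring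
          _ ≤ (n : ℝ) ^ 2 * x * ((n : ℝ) ^ 4 * x ^ 2) :=
              mul_le_of_le_one_right (by positivity) h6
          _ ≤ _ := mul_le_mul_of_nonneg_right h1 h2
      have h8 : (n : ℝ) ^ 5 * x ^ 3 * (1 - x) ≤ c * ((n : ℝ) ^ 4 * x ^ 2) := by
        calc (n : ℝ) ^ 5 * x ^ 3 * (1 - x) ≤ (n : ℝ) ^ 5 * x ^ 3 * n :=
              mul_le_mul_of_nonneg_left (by linarith) (by positivity)
          _ = (n : ℝ) ^ 2 * x * ((n : ℝ) ^ 4 * x ^ 2) := by ring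
          _ ≤ _ := mul_le_mul_of_nonneg_right h1 h2
      have h9 : (n : ℝ) ^ 4 * x ^ 2 * (1 - x) ≤ (n : ℝ) ^ 4 * x ^ 2 :=
        mul_le_of_le_one_right h2 (by linarith)
      linarith
  · have hzero : ∀ n, (1 - √2 * (p n : ℝ)) ^ 2 = 0 := fun n => by
      rw [h n, mul_one_div_cancel (by positivity), sub_self, zero_pow two_ne_zero]
    obtain ⟨x, hx⟩ : ∃ x : ℝ, ∀ n, (p n : ℝ) = x := ⟨1 / √2, h⟩
    have hx0 : 0 < x := hx 0 ▸ (hp 0).1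
    have hx1 : 0 < 1 - x := hx 0 ▸ hq 0
    have hpos : 0 < x ^ 3 * (1 - x) := by positivity
    refine isTheta_of_bounds (a := 1 / (x ^ 3 * (1 - x))) (b := 2)
      (Eventually.of_forall fun n => by positivity) (Eventually.of_forall hnonneg)
      (Eventually.of_forall fun n => ?_) ?_
    · have h1 := hC n
      unfold varianceOrder
      rw [hzero, hx] at *
      rw [div_mul_eq_mul_div, one_mul, le_div_iff₀ hpos]
      linarith
    · filter_upwards [eventually_ge_atTop 1] with n hn
      have hn' : (1 : ℝ) ≤ n := by exact_mod_cast hn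
      unfold varianceOrder
      rw [hzero, hx]
      have h1 : x ^ 3 * (1 - x) ≤ 1 :=
        mul_le_one₀ (pow_le_one₀ hx0.le (by linarith)) hx1.le (by linarith)
      have h2 : x ^ 2 * (1 - x) ≤ 1 :=
        mul_le_one₀ (pow_le_one₀ hx0.le (by linarith)) hx1.le (by linarith)
      have h3 : (n : ℝ) ^ 4 ≤ (n : ℝ) ^ 5 := pow_le_pow_right₀ hn' (by norm_num)
      have h4 := mul_le_mul_of_nonneg_left h1 (show 0 ≤ (n : ℝ) ^ 5 by positivity)
      have h5 := mul_le_mul_of_nonneg_left h2 (show 0 ≤ (n : ℝ) ^ 4 by positivity)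
      linarith
  · rw [hlarge, hlarge', ← tendsto_varianceOrder_iff hp]
    constructor
    · intro h
      have h1 : Tendsto (fun n : ℕ => sepEdgeVariance n (p n) / 3300) atTop atTop :=
        h.atTop_div_const (by norm_num)
      refine tendsto_atTop_mono' _ ?_ h1
      filter_upwards [hbounds] with n hn
      linarith [hn.2]
    · intro h
      have h1 : Tendsto (fun n : ℕ => varianceOrder n (p n) / 56000000) atTop atTop :=
        h.atTop_div_const (by norm_num)
      refine tendsto_atTop_mono' _ ?_ h1
      filter_upwards [hbounds] with n hn
      linarith [hn.1]
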